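/- All logarithms are to base $2$. Let $G=(L,R,E)$ be a finite simple bipartite graph with $n=|L|+|R|$ vertices, average degree $d=2|E|/n$, maximum density $\rho^*=\max_{\emptyset\ne S\subseteq L\cup R}|E(G[S])|/|S|$, and maximum log-skewness $$\mathrm{Skew}(G)=\max_{H}\ \frac{\log(|A|/|B|)}{\log\big(d\log^2 n/d_A\big)},$$ where $H=(A,B,E_H)$ ranges over the subgraphs of $G$ with $A\subseteq L$, $B\subseteq R$, $|A|\ge|B|\geq 1$ and minimum left degree $d_A=\min_{u\in A}\deg_H(u)\ge 1$. Call $G$ admissible if $d\ge 1$ and every left vertex has degree at most $\min\{4\rho^*,\ d\log n\}$. For constants $K,M$, a $(K,M)$-decomposition of $G$ is a partition of $E$ into $h\le M\log\log n$ (possibly empty) edge sets $G_1,\dots,G_h$ such that, with $f_i=2^{2^i}$, every left vertex has degree at most $K\rho^*/f_i$ in $G_i$ and every right vertex has degree at most $K\rho^*(f_i\log n)^{2\,\mathrm{Skew}(G)}$ in $G_i$ (that is, $G_i$ is $f_i$-skew-biregular). Threshold-Greedy, with a given $(K,M)$-decomposition and thresholds $$\alpha_i=c\left(\frac{\rho^*}{d}+\mathrm{Skew}(G)\right)\left(\frac{\log\log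 n}{2^i}+1\right),$$ processes edges arriving one by one. When $e=(u,v)\in G_i$ with $u\in L$, $v\in R$ arrives: if the current load on $u$ due to edges of $G_i$ is less than $\alpha_i$, then $e$ is assigned to $u$ (a threshold edge). Otherwise $e$ is a greedy edge; letting $\ell_g(w)$ be the current load on $w$ due to greedy edges of all classes, $e$ is assigned to $u$ if $\ell_g(u)<\ell_g(v)$ and to $v$ otherwise. Let $G_{\mathrm{greedy}}$ be the graph on $L\cup R$ formed by the greedy edges after $n$ arrivals, drawn independently and uniformly from $E$. Statement: there are absolute constants $K_0,M_0$ such that for all $K\ge K_0$, $M\ge M_0$ there is $c_0>0$ such that for every $k\in\mathbb N$ there are $C,N$ for which the following holds. For every admissible $G$ with $n\ge N$ vertices, a $(K,M)$-decomposition exists, and for every $(K,M)$-decomposition and every $c\ge c_0$, with probability at least $1-n^{-k}$ every connected component of $G_{\mathrm{greedy}}$ has at most $C\log^2 n$ vertices. -/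

import Mathlib

open MeasureTheory ProbabilityTheory

noncomputable section

namespace ThresholdGreedy

universe u v

/-! A (simple) bipartite graph with finite sides `L` and `R` is given by its edge set
`E : Finset (L × R)`; the edge `(u, v)` joins the left vertex `u` to the right vertex `v`.
All logarithms are to base `2`. -/

/-- The number `n` of vertices. -/
def order (L : Type u) (R : Type v) [Fintype L] [Fintype R] : ℕ :=
  Fintype.card L + Fintype.card R

/-- The average degree `2 |E| / n`. -/
def avgDeg {L : Type u} {R : Type v} [Fintype L] [Fintype R] (E : Finset (L × R)) : ℝ :=
  2 * (E.card : ℝ) / (order L R : ℝ)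

/-- The degree of the left vertex `x` in the graph with edge set `F`. -/
def leftDeg {L : Type u} {R : Type v} [DecidableEq L] (F : Finset (L × R)) (x : L) : ℕ :=
  (F.filter fun e => e.1 = x).card

/-- The degree of the right vertex `y` in the graph with edge set `F`. -/
def rightDeg {L : Type u} {R : Type v} [DecidableEq R] (F : Finset (L × R)) (y : R) : ℕ :=
  (F.filter fun e => e.2 = y).card

/-- The maximum density `ρ*`: the maximum of `|E[S]| / |S|` over all vertex sets `S`, where a
vertex set is a pair consisting of its left part and its right part. (The empty set contributes
`0 / 0 = 0`.) -/
def maxDensity {L : Type u} {R : Type v} [Fintype L] [Fintype R] [DecidableEq L] [DecidableEq R]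
    (E : Finset (L × R)) : ℝ :=
  ⨆ S : Finset L × Finset R,
    ((E.filter fun e => e.1 ∈ S.1 ∧ e.2 ∈ S.2).card : ℝ) / ((S.1.card : ℝ) + (S.2.card : ℝ))

/-- The subgraphs `H = (A, B, F)` of `E` that are relevant for log-skewness: `A` is a nonempty set
of left vertices, `B` a set of right vertices, `|A| ≥ |B|`, and the minimum left degree of `H` is
positive (in particular `B` is nonempty), so that the quotient defining the log-skewness makes
sense. -/
structure SkewSubgraph {L : Type u} {R : Type v} [DecidableEq L] (E : Finset (L × R)) where
  /-- the left vertices of the subgraph -/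
  A : Finset L
  /-- the right vertices of the subgraph -/
  B : Finset R
  /-- the edges of the subgraph -/
  F : Finset (L × R)
  subset : F ⊆ E
  between : F ⊆ A ×ˢ B
  nonempty : A.Nonempty
  card_le : B.card ≤ A.card
  deg_pos : ∀ x ∈ A, 0 < leftDeg F x

/-- The minimum left degree of a subgraph. -/
def SkewSubgraph.minLeftDeg {L : Type u} {R : Type v} [DecidableEq L] {E : Finset (L × R)}
    (H : SkewSubgraph E) : ℕ :=
  H.A.inf' H.nonempty (leftDeg H.F)

/-- The log-skewness `log (|A| / |B|) / log (d log² n / d_A)` of a subgraph, `d` being the average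
degree of the ambient graph and `d_A` the minimum left degree of the subgraph. -/
def SkewSubgraph.logSkewness {L : Type u} {R : Type v} [Fintype L] [Fintype R] [DecidableEq L]
    {E : Finset (L × R)} (H : SkewSubgraph E) : ℝ :=
  Real.logb 2 ((H.A.card : ℝ) / (H.B.card : ℝ)) /
    Real.logb 2 (avgDeg E * Real.logb 2 (order L R : ℝ) ^ 2 / (H.minLeftDeg : ℝ))

/-- The maximum log-skewness `Skew(G)`, a maximum over finitely many subgraphs. -/
def skew {L : Type u} {R : Type v} [Fintype L] [Fintype R] [DecidableEq L]
    (E : Finset (L × R)) : ℝ :=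
  ⨆ H : SkewSubgraph E, H.logSkewness

/-- The standing assumptions on the base graph: the average degree is at least `1`, the graph is
left-degree-bounded (`Δ_L ≤ 4 ρ*`), and `Δ_L ≤ d log n`. -/
structure IsAdmissible {L : Type u} {R : Type v} [Fintype L] [Fintype R] [DecidableEq L]
    [DecidableEq R] (E : Finset (L × R)) : Prop where
  one_le_avgDeg : 1 ≤ avgDeg E
  left_degree_bounded : ∀ x : L, (leftDeg E x : ℝ) ≤ 4 * maxDensity E
  left_degree_le_log : ∀ x : L, (leftDeg E x : ℝ) ≤ Real.logb 2 (order L R : ℝ) * avgDeg E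

/-- The subgraph `F` of `E` is `f`-skew-biregular, with hidden constant `K`. -/
structure IsSkewBiregular {L : Type u} {R : Type v} [Fintype L] [Fintype R] [DecidableEq L]
    [DecidableEq R] (E : Finset (L × R)) (K f : ℝ) (F : Finset (L × R)) : Prop where
  subset : F ⊆ E
  left_degree_le : ∀ x : L, (leftDeg F x : ℝ) ≤ K * (maxDensity E / f)
  right_degree_le : ∀ y : R, (rightDeg F y : ℝ) ≤
    K * (maxDensity E * (f * Real.logb 2 (order L R : ℝ)) ^ (2 * skew E))

/-- A partition of the edges of `E` into `h` classes is given by a labelling `cls` of the edges.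
The classes are numbered `1, …, h`; the element `i : Fin h` stands for class number `i + 1`. -/
def edgeClass {L : Type u} {R : Type v} {h : ℕ} (E : Finset (L × R)) (cls : L × R → Fin h)
    (i : Fin h) : Finset (L × R) :=
  E.filter fun e => cls e = i

/-- `cls` partitions the edges of `E` into `h ≤ M log log n` subgraphs, the `i`-th of which is
`2 ^ 2 ^ i`-skew-biregular with hidden constant `K`. -/
structure IsSkewDecomposition {L : Type u} {R : Type v} [Fintype L] [Fintype R] [DecidableEq L]
    [DecidableEq R] (E : Finset (L × R)) (K M : ℝ) {h : ℕ} (cls : L × R → Fin h) : Prop where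
  card_le : (h : ℝ) ≤ M * Real.logb 2 (Real.logb 2 (order L R : ℝ))
  biregular : ∀ i : Fin h,
    IsSkewBiregular E K (2 ^ 2 ^ ((i : ℕ) + 1)) (edgeClass E cls i)

/-- The threshold `c (ρ* / d + Skew(G)) (log log n / 2 ^ i + 1)` of class `i`. -/
def threshold {L : Type u} {R : Type v} [Fintype L] [Fintype R] [DecidableEq L] [DecidableEq R]
    (E : Finset (L × R)) (c : ℝ) {h : ℕ} (i : Fin h) : ℝ :=
  c * (maxDensity E / avgDeg E + skew E) *
    (Real.logb 2 (Real.logb 2 (order L R : ℝ)) / 2 ^ ((i : ℕ) + 1) + 1)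

/-- The state of the algorithm. -/
structure State (L : Type u) (R : Type v) (h : ℕ) where
  /-- the load on each left vertex due to the edges of each class -/
  classLoad : L → Fin h → ℕ
  /-- the load on each vertex due to non-threshold edges of all classes -/
  greedyLoad : L ⊕ R → ℕ

/-- Add one to the value of `g` at `a`. -/
def bump {α : Type*} [DecidableEq α] (g : α → ℕ) (a : α) : α → ℕ :=
  Function.update g a (g a + 1)

/-- The edge `e` arriving in state `s` is a threshold edge; otherwise it is a greedy edge. -/
def IsThreshold {L : Type u} {R : Type v} {h : ℕ} (α : Fin h → ℝ) (cls : L × R → Fin h)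
    (s : State L R h) (e : L × R) : Prop :=
  (s.classLoad e.1 (cls e) : ℝ) < α (cls e)

open Classical in
/-- One step of Threshold-Greedy with thresholds `α`, on arrival of the edge `e`. -/
def step {L : Type u} {R : Type v} {h : ℕ} (α : Fin h → ℝ) (cls : L × R → Fin h)
    (s : State L R h) (e : L × R) : State L R h :=
  if IsThreshold α cls s e then
    -- threshold rule: assign the edge to its left endpoint
    { classLoad := Function.update s.classLoad e.1 (bump (s.classLoad e.1) (cls e))
      greedyLoad := s.greedyLoad }
  else if s.greedyLoad (Sum.inl e.1) < s.greedyLoad (Sum.inr e.2) then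
    -- greedy rule, edge assigned to its left endpoint
    { classLoad := Function.update s.classLoad e.1 (bump (s.classLoad e.1) (cls e))
      greedyLoad := bump s.greedyLoad (Sum.inl e.1) }
  else
    -- greedy rule, edge assigned to its right endpoint
    { classLoad := s.classLoad
      greedyLoad := bump s.greedyLoad (Sum.inr e.2) }

/-- The state after the first `t` arrivals of the sequence `ω` (all loads are `0` initially). -/
def stateAt {L : Type u} {R : Type v} {h n : ℕ} (α : Fin h → ℝ) (cls : L × R → Fin h)
    (ω : Fin n → L × R) : ℕ → State L R h
  | 0 => { classLoad := fun _ _ => 0, greedyLoad := fun _ => 0 }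
  | t + 1 =>
    if ht : t < n then step α cls (stateAt α cls ω t) (ω ⟨t, ht⟩) else stateAt α cls ω t

/-- The graph on all vertices formed by the greedy edges among the arrivals `ω`. -/
def greedyGraph {L : Type u} {R : Type v} {h n : ℕ} (α : Fin h → ℝ) (cls : L × R → Fin h)
    (ω : Fin n → L × R) : SimpleGraph (L ⊕ R) :=
  SimpleGraph.fromEdgeSet
    {z | ∃ t : Fin n, ¬ IsThreshold α cls (stateAt α cls ω t) (ω t) ∧
      z = s(Sum.inl (ω t).1, Sum.inr (ω t).2)}

/-- The edges of `E`, as a discrete measurable space. -/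
def Edge {L : Type u} {R : Type v} (E : Finset (L × R)) : Type (max u v) := {e : L × R // e ∈ E}

instance {L : Type u} {R : Type v} (E : Finset (L × R)) : Fintype (Edge E) :=
  inferInstanceAs (Fintype {e : L × R // e ∈ E})

instance {L : Type u} {R : Type v} (E : Finset (L × R)) : MeasurableSpace (Edge E) := ⊤

instance {L : Type u} {R : Type v} (E : Finset (L × R)) : DiscreteMeasurableSpace (Edge E) :=
  ⟨fun _ => MeasurableSpace.measurableSet_top⟩

/-- The law of `n` independent arrivals, each uniformly distributed on the edges of `E`. -/
def arrivals {L : Type u} {R : Type v} (E : Finset (L × R)) (n : ℕ) :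
    Measure (Fin n → Edge E) :=
  Measure.pi fun _ => uniformOn (Set.univ : Set (Edge E))

end ThresholdGreedy

end

namespace ThresholdGreedy

universe u v

set_option linter.unusedSectionVars false

variable {L : Type u} {R : Type v} [Fintype L] [Fintype R] [DecidableEq L] [DecidableEq R]

/-! Write `Λ = log n` and let `f` be the skewness parameter of a class.

Decomposition. Start with all of `E` in class 1 and repeatedly split the last class. Given a target
left degree `τ`, the left vertices of degree above `τ` into a set `B` of right vertices number at
most `|B|` times a power of `d Λ² / τ` with exponent `Skew(G)`. Double counting then finds a vertex
of `B` with few edges to them (`exists_few_edges`). Removing such right vertices one at a time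
(`exists_peeling`) separates a part of small right degree from a remainder of left degree at most
`τ`. Since `f` squares from class to class, the left degree bound falls below 1 after about `log log
n` classes and the last remainder is empty.

Components. The greedy rule itself plays no role: a greedy edge of class `i` at `x` only witnesses
at least `α_i` earlier arrivals of class `i` at `x`. A component with many left vertices can
therefore be explored one left vertex at a time. From a right vertex `y` adjacent to the explored
part, a greedy edge leads to a new left vertex `x` together with its star of earlier arrivals; then
some arrival at an explored left vertex supplies the next right vertex
(`exists_chain_of_component`). A union bound over all such chains (`prob_chain_le`) multiplies two
factors per stage. The extension costs `O(Λ^(-6))`, because the thresholds make a full star unlikely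
enough to pay for the right degree (`extensionWeight_le`). The choice of the linking arrival costs
only `O(Λ²)`, as long as all arrival degrees are `O(Λ)`. So a chain of `⌈Λ⌉` stages has polynomially
small probability. Otherwise a component has `O(Λ)` left vertices, each with `O(Λ)` arrivals, hence
`O(Λ²)` vertices (`ncard_supp_le`). -/

/-! ### Maximum density and log-skewness -/

theorem leftDeg_mono {F F' : Finset (L × R)} (h : F ⊆ F') (x : L) : leftDeg F x ≤ leftDeg F' x :=
  Finset.card_le_card (Finset.filter_subset_filter _ h)

/-- Needed so that the supremum in `skew` is bounded above and dominates every single subgraph. -/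
theorem finite_skewSubgraph (E : Finset (L × R)) : Finite (SkewSubgraph E) := by
  refine Finite.of_injective
    (fun H : SkewSubgraph E => ((H.A, H.B, H.F) : Finset L × Finset R × Finset (L × R))) ?_
  rintro ⟨⟩ ⟨⟩ h
  simp only [Prod.mk.injEq] at h
  obtain ⟨rfl, rfl, rfl⟩ := h
  rfl

theorem density_le_maxDensity (E : Finset (L × R)) (S : Finset L × Finset R) :
    ((E.filter fun e => e.1 ∈ S.1 ∧ e.2 ∈ S.2).card : ℝ) / ((S.1.card : ℝ) + (S.2.card : ℝ)) ≤
      maxDensity E := by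
  unfold maxDensity
  exact le_ciSup (f := fun S : Finset L × Finset R =>
    ((E.filter fun e => e.1 ∈ S.1 ∧ e.2 ∈ S.2).card : ℝ) / ((S.1.card : ℝ) + (S.2.card : ℝ)))
    (Set.finite_range _).bddAbove S

theorem avgDeg_le_two_mul_maxDensity (E : Finset (L × R)) : avgDeg E ≤ 2 * maxDensity E := by
  have h := density_le_maxDensity E (Finset.univ, Finset.univ)
  simp only [Finset.mem_univ, and_self, Finset.filter_true, Finset.card_univ] at h
  unfold avgDeg order
  push_cast
  rw [mul_div_assoc]
  linarith

/-- A crude bound, used only to see that the last class of the decomposition is empty. -/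
theorem maxDensity_le_order (E : Finset (L × R)) : maxDensity E ≤ order L R := by
  refine Real.iSup_le (fun S => ?_) (Nat.cast_nonneg _)
  refine div_le_of_le_mul₀ (by positivity) (by positivity) ?_
  have h1 : (E.filter fun e => e.1 ∈ S.1 ∧ e.2 ∈ S.2).card ≤ S.1.card * S.2.card := by
    rw [← Finset.card_product]
    refine Finset.card_le_card fun e he => ?_
    rw [Finset.mem_filter] at he
    exact Finset.mem_product.2 he.2
  have h2 : S.2.card ≤ Fintype.card R := Finset.card_le_univ _
  have h3 : (E.filter fun e => e.1 ∈ S.1 ∧ e.2 ∈ S.2).card ≤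
      (Fintype.card L + Fintype.card R) * (S.1.card + S.2.card) := by nlinarith
  unfold order
  exact_mod_cast h3

/-- For `x` not exceeding the maximum left degree, `log (d log² n / x)` is positive. -/
theorem IsAdmissible.one_lt_of_le_leftDeg {E : Finset (L × R)} (hE : IsAdmissible E)
    (hn : 1 < Real.logb 2 (order L R : ℝ)) {x : L} {a : ℝ} (ha : 0 < a) (hx : a ≤ leftDeg E x) :
    1 < avgDeg E * Real.logb 2 (order L R : ℝ) ^ 2 / a := by
  rw [one_lt_div ha]
  have h1 := hE.one_le_avgDeg
  have h2 := hE.left_degree_le_log x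
  have h3 : 0 < Real.logb 2 (order L R : ℝ) * avgDeg E := by positivity
  nlinarith

theorem SkewSubgraph.exists_minLeftDeg {E : Finset (L × R)} (H : SkewSubgraph E) :
    ∃ x ∈ H.A, H.minLeftDeg = leftDeg H.F x :=
  Finset.exists_mem_eq_inf' H.nonempty _

theorem IsAdmissible.one_lt_skew_den {E : Finset (L × R)} (hE : IsAdmissible E)
    (hn : 1 < Real.logb 2 (order L R : ℝ)) (H : SkewSubgraph E) :
    1 < avgDeg E * Real.logb 2 (order L R : ℝ) ^ 2 / (H.minLeftDeg : ℝ) := by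
  obtain ⟨x, hx, h⟩ := H.exists_minLeftDeg
  rw [h]
  exact hE.one_lt_of_le_leftDeg hn (Nat.cast_pos.2 (H.deg_pos x hx))
    (Nat.cast_le.2 (leftDeg_mono H.subset x))

theorem SkewSubgraph.card_B_pos {E : Finset (L × R)} (H : SkewSubgraph E) : 0 < H.B.card := by
  obtain ⟨x, hx⟩ := H.nonempty
  obtain ⟨e, he⟩ := Finset.card_pos.1 (H.deg_pos x hx)
  exact Finset.card_pos.2 ⟨e.2, (Finset.mem_product.1 (H.between (Finset.mem_filter.1 he).1)).2⟩

theorem IsAdmissible.skew_nonneg {E : Finset (L × R)} (hE : IsAdmissible E)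
    (hn : 1 < Real.logb 2 (order L R : ℝ)) : 0 ≤ skew E := by
  refine Real.iSup_nonneg fun H => ?_
  refine div_nonneg (Real.logb_nonneg one_lt_two ?_)
    (Real.logb_nonneg one_lt_two (hE.one_lt_skew_den hn H).le)
  rw [one_le_div (Nat.cast_pos.2 H.card_B_pos)]
  exact_mod_cast H.card_le

/-- The defining property of the maximum log-skewness, as a bound on `|A|`. -/
theorem IsAdmissible.card_le_of_skew {E : Finset (L × R)} (hE : IsAdmissible E)
    (hn : 1 < Real.logb 2 (order L R : ℝ)) (H : SkewSubgraph E) {a : ℝ} (ha : 0 < a)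
    (hH : a ≤ H.minLeftDeg) :
    (H.A.card : ℝ) ≤
      H.B.card * (avgDeg E * Real.logb 2 (order L R : ℝ) ^ 2 / a) ^ skew E := by
  have hd := hE.one_le_avgDeg
  have h1 := hE.one_lt_skew_den hn H
  have hs : H.logSkewness ≤ skew E := by
    have := finite_skewSubgraph E
    exact le_ciSup (f := fun H : SkewSubgraph E => H.logSkewness)
      (Set.finite_range _).bddAbove H
  have hB : (0 : ℝ) < H.B.card := Nat.cast_pos.2 H.card_B_pos
  have hA : (0 : ℝ) < H.A.card := Nat.cast_pos.2 (Finset.card_pos.2 H.nonempty)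
  unfold SkewSubgraph.logSkewness at hs
  rw [div_le_iff₀ (Real.logb_pos one_lt_two h1), ← Real.logb_rpow_eq_mul_logb_of_pos (by linarith),
    Real.logb_le_logb one_lt_two (by positivity) (by positivity), div_le_iff₀ hB] at hs
  rw [mul_comm]
  refine hs.trans (mul_le_mul_of_nonneg_right ?_ hB.le)
  refine Real.rpow_le_rpow (by linarith) ?_ (hE.skew_nonneg hn)
  gcongr

/-! ### The decomposition -/

/-- Repeatedly remove a right vertex with few edges to the left vertices of degree above `τ`. -/
theorem exists_peeling (H : Finset (L × R)) (τ D : ℝ) (hτ : 0 ≤ τ) (hD : 0 ≤ D)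
    (hH : ∀ B : Finset R, B.Nonempty → ∃ y ∈ B,
      ((H.filter fun e => e.2 = y ∧
        τ < leftDeg (H.filter fun e' => e'.2 ∈ B) e.1).card : ℝ) ≤ D)
    (B : Finset R) :
    ∃ F ⊆ H.filter fun e => e.2 ∈ B, (∀ y, (rightDeg F y : ℝ) ≤ D) ∧
      ∀ x, (leftDeg ((H.filter fun e => e.2 ∈ B) \ F) x : ℝ) ≤ τ := by
  induction B using Finset.strongInduction with
  | H B ih =>
  rcases B.eq_empty_or_nonempty with rfl | hB
  · exact ⟨∅, by simp, by simp [rightDeg, hD], by simp [leftDeg, hτ]⟩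
  obtain ⟨y, hy, hyD⟩ := hH B hB
  obtain ⟨F, hF, hFr, hFl⟩ := ih (B.erase y) (Finset.erase_ssubset hy)
  have hFy : ∀ e ∈ F, e.2 ≠ y ∧ e.2 ∈ B ∧ e ∈ H := fun e he => by
    have := Finset.mem_filter.1 (hF he)
    exact ⟨Finset.ne_of_mem_erase this.2, Finset.mem_of_mem_erase this.2, this.1⟩
  -- Only the edges from `y` to currently heavy left vertices are kept. A heavy vertex then leaves
  -- no edge at `y` in the remainder, so induction applies to it; a light one has degree at most `τ`
  -- before anything is removed.
  refine ⟨F ∪ H.filter fun e => e.2 = y ∧ τ < leftDeg (H.filter fun e' => e'.2 ∈ B) e.1,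
    ?_, ?_, ?_⟩
  · intro e he
    rcases Finset.mem_union.1 he with he | he
    · exact Finset.mem_filter.2 ⟨(hFy e he).2.2, (hFy e he).2.1⟩
    · obtain ⟨h1, h2, -⟩ := Finset.mem_filter.1 he
      exact Finset.mem_filter.2 ⟨h1, h2 ▸ hy⟩
  · intro z
    by_cases hz : z = y
    · subst hz
      refine le_trans (Nat.cast_le.2 (Finset.card_le_card fun e he => ?_)) hyD
      obtain ⟨h1, h2⟩ := Finset.mem_filter.1 he
      rcases Finset.mem_union.1 h1 with h | h
      · exact absurd h2 (hFy e h).1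
      · exact h
    · refine le_trans (Nat.cast_le.2 (Finset.card_le_card fun e he => ?_)) (hFr z)
      obtain ⟨h1, h2⟩ := Finset.mem_filter.1 he
      rcases Finset.mem_union.1 h1 with h | h
      · exact Finset.mem_filter.2 ⟨h, h2⟩
      · exact absurd (h2.symm.trans (Finset.mem_filter.1 h).2.1) hz
  · intro x
    by_cases hx : τ < leftDeg (H.filter fun e' => e'.2 ∈ B) x
    · refine le_trans (Nat.cast_le.2 (Finset.card_le_card fun e he => ?_)) (hFl x)
      obtain ⟨h1, rfl⟩ := Finset.mem_filter.1 he
      simp only [Finset.mem_sdiff, Finset.mem_filter, Finset.mem_union, Finset.mem_erase,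
        not_or, not_and, and_true] at h1 ⊢
      exact ⟨⟨h1.1.1, fun h => h1.2.2 h1.1.1 h hx, h1.1.2⟩, h1.2.1⟩
    · exact le_trans (Nat.cast_le.2 (leftDeg_mono Finset.sdiff_subset x)) (not_lt.1 hx)

/-- A subgraph of left degree at most `a` has, in every nonempty set of right vertices, one with
few edges to the left vertices of degree above `τ`. -/
theorem IsAdmissible.exists_few_edges {E : Finset (L × R)} (hE : IsAdmissible E)
    (hn : 1 < Real.logb 2 (order L R : ℝ)) {H : Finset (L × R)} (hHE : H ⊆ E) {a τ X : ℝ}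
    (ha : ∀ x, (leftDeg H x : ℝ) ≤ a) (ha0 : 0 ≤ a) (hτ : 0 < τ)
    (hX : (avgDeg E * Real.logb 2 (order L R : ℝ) ^ 2 / τ) ^ skew E ≤ X) (hX1 : 1 ≤ X)
    {B : Finset R} (hB : B.Nonempty) :
    ∃ y ∈ B, ((H.filter fun e => e.2 = y ∧
      τ < leftDeg (H.filter fun e' => e'.2 ∈ B) e.1).card : ℝ) ≤ a * X := by
  set F := H.filter fun e => e.2 ∈ B with hF
  set A : Finset L := Finset.univ.filter fun x => τ < leftDeg F x with hA
  set F' := F.filter fun e => e.1 ∈ A with hF'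
  have hdeg : ∀ x ∈ A, leftDeg F' x = leftDeg F x := fun x hx => by
    unfold leftDeg
    congr 1
    ext e
    simp only [hF', Finset.mem_filter]
    constructor
    · rintro ⟨⟨h1, -⟩, h2⟩
      exact ⟨h1, h2⟩
    · rintro ⟨h1, rfl⟩
      exact ⟨⟨h1, hx⟩, rfl⟩
  have hmem : ∀ x ∈ A, τ < leftDeg F x := fun x hx => (Finset.mem_filter.1 hx).2
  have hAB : (A.card : ℝ) ≤ B.card * X := by
    rcases A.eq_empty_or_nonempty with h | hne
    · rw [h, Finset.card_empty, Nat.cast_zero]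
      positivity
    -- Log-skewness only speaks of subgraphs with `|A| ≥ |B|`; in the other case `1 ≤ X` suffices.
    rcases le_total A.card B.card with h | h
    · have h' : (A.card : ℝ) ≤ B.card := Nat.cast_le.2 h
      nlinarith [(Nat.cast_nonneg B.card : (0 : ℝ) ≤ B.card)]
    let S : SkewSubgraph E :=
      { A := A
        B := B
        F := F'
        subset := (Finset.filter_subset _ _).trans ((Finset.filter_subset _ _).trans hHE)
        between := fun e he => by
          simp only [hF', hF, Finset.mem_filter] at he
          exact Finset.mem_product.2 ⟨he.2, he.1.2⟩
        nonempty := hne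
        card_le := h
        deg_pos := fun x hx => by
          rw [hdeg x hx]
          exact_mod_cast hτ.trans (hmem x hx) }
    have hS : τ ≤ S.minLeftDeg := by
      obtain ⟨x, hx, h⟩ := S.exists_minLeftDeg
      rw [h]
      exact (hdeg x hx).symm ▸ (hmem x hx).le
    exact (hE.card_le_of_skew hn S hτ hS).trans
      (mul_le_mul_of_nonneg_left hX (Nat.cast_nonneg _))
  have hcount : F'.card ≤ ∑ x ∈ A, leftDeg H x := by
    rw [Finset.card_eq_sum_card_fiberwise (s := F') (f := Prod.fst) (t := A)
      (fun e he => (Finset.mem_filter.1 (Finset.mem_coe.1 he)).2)]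
    refine Finset.sum_le_sum fun x _ => ?_
    exact leftDeg_mono ((Finset.filter_subset _ _).trans (Finset.filter_subset _ _)) x
  have hcount2 : (F'.card : ℝ) ≤ B.card * (a * X) := by
    have : (F'.card : ℝ) ≤ ∑ x ∈ A, (leftDeg H x : ℝ) := by exact_mod_cast hcount
    calc (F'.card : ℝ) ≤ ∑ x ∈ A, (leftDeg H x : ℝ) := this
      _ ≤ ∑ _x ∈ A, a := Finset.sum_le_sum fun x _ => ha x
      _ = A.card * a := by rw [Finset.sum_const, nsmul_eq_mul]
      _ ≤ (B.card * X) * a := mul_le_mul_of_nonneg_right hAB ha0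
      _ = _ := by ring
  -- Double counting of `F'`: from the left it has at most `|A| a ≤ |B| a X` edges, while more than
  -- `a X` edges at every vertex of `B` would give more.
  by_contra! hcon
  have : (B.card : ℝ) * (a * X) < F'.card := by
    rw [Finset.card_eq_sum_card_fiberwise (s := F') (f := Prod.snd) (t := B)
      (fun e he => (Finset.mem_filter.1 (Finset.mem_filter.1 (Finset.mem_coe.1 he)).1).2)]
    push_cast
    rw [← nsmul_eq_mul, ← Finset.sum_const]
    refine Finset.sum_lt_sum_of_nonempty hB fun y hy => (hcon y hy).trans_le ?_
    refine Nat.cast_le.2 (Finset.card_le_card fun e he => ?_)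
    simp only [hF', hF, hA, Finset.mem_filter, Finset.mem_univ, true_and] at he ⊢
    exact ⟨⟨⟨he.1, he.2.1 ▸ hy⟩, he.2.2⟩, he.2.1⟩
  linarith

/-- Iterating the peeling: all labels but the last give skew-biregular graphs, and the last one
has small left degrees. -/
theorem IsAdmissible.exists_labelling {E : Finset (L × R)} (hE : IsAdmissible E)
    (hn : 1 < Real.logb 2 (order L R : ℝ)) {K : ℝ} (hK : 16 ≤ K) (j : ℕ) :
    ∃ lab : L × R → ℕ, (∀ e, lab e ≤ j) ∧
      (∀ i ≤ j, ∀ x, (leftDeg (E.filter fun e => lab e = i) x : ℝ) ≤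
        K * (maxDensity E / 2 ^ 2 ^ (i + 1))) ∧
      ∀ i < j, ∀ y, (rightDeg (E.filter fun e => lab e = i) y : ℝ) ≤
        K * (maxDensity E * (2 ^ 2 ^ (i + 1) * Real.logb 2 (order L R : ℝ)) ^ (2 * skew E)) := by
  have hd := hE.one_le_avgDeg
  have hρ := avgDeg_le_two_mul_maxDensity E
  have hs := hE.skew_nonneg hn
  induction j with
  | zero =>
    refine ⟨fun _ => 0, fun _ => le_rfl, fun i hi x => ?_, fun i hi => absurd hi (by omega)⟩
    obtain rfl : i = 0 := by omega
    simp only [Finset.filter_true]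
    -- The first class has `f = 4`, so `4 ρ* ≤ K ρ* / 4` is where `16 ≤ K` comes from.
    refine (hE.left_degree_bounded x).trans ?_
    norm_num
    nlinarith
  | succ j ih =>
    obtain ⟨lab, hlab, hl, hr⟩ := ih
    set H := E.filter fun e => lab e = j with hH
    set X : ℝ := (2 ^ 2 ^ (j + 1) * Real.logb 2 (order L R : ℝ)) ^ (2 * skew E) with hXdef
    have hf : (1 : ℝ) ≤ 2 ^ 2 ^ (j + 1) := one_le_pow₀ one_le_two
    have hX1 : 1 ≤ X := Real.one_le_rpow (by nlinarith) (by positivity)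
    have hρ0 : 0 < maxDensity E := by linarith
    have hX : (avgDeg E * Real.logb 2 (order L R : ℝ) ^ 2 /
        (K * (maxDensity E / 2 ^ 2 ^ (j + 2)))) ^ skew E ≤ X := by
      -- The next parameter is the square of the current `f`, and `d ≤ 2 ρ* ≤ K ρ*`; hence the base
      -- on the left is at most `(f log n)²`, which explains the exponent `2 * skew E`.
      rw [hXdef, Real.rpow_mul (by positivity), Real.rpow_two]
      refine Real.rpow_le_rpow (by positivity) ?_ hs
      rw [div_le_iff₀ (by positivity), mul_pow, ← pow_mul, ← pow_succ]
      have : (2 ^ 2 ^ (j + 1 + 1) * Real.logb 2 (order L R : ℝ) ^ 2 *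
        (K * (maxDensity E / 2 ^ 2 ^ (j + 2)))) =
          Real.logb 2 (order L R : ℝ) ^ 2 * (K * maxDensity E) := by
        field_simp
      rw [this, mul_comm]
      refine mul_le_mul_of_nonneg_left ?_ (by positivity)
      nlinarith
    have ha0 : 0 ≤ K * (maxDensity E / 2 ^ 2 ^ (j + 1)) := by positivity
    obtain ⟨F, hF, hFr, hFl⟩ := exists_peeling H (K * (maxDensity E / 2 ^ 2 ^ (j + 2)))
      (K * (maxDensity E / 2 ^ 2 ^ (j + 1)) * X) (by positivity) (by positivity)
      (fun B hB => hE.exists_few_edges hn (Finset.filter_subset _ _) (hl j le_rfl) ha0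
        (by positivity) hX hX1 hB) Finset.univ
    simp only [Finset.mem_univ, Finset.filter_true] at hF hFl
    refine ⟨fun e => if e ∈ H \ F then j + 1 else lab e, fun e => ?_, fun i hi x => ?_,
      fun i hi y => ?_⟩
    · dsimp only
      split_ifs
      · exact le_rfl
      · exact (hlab e).trans (Nat.le_succ j)
    · rcases Nat.lt_or_ge i (j + 1) with hij | hij
      · refine le_trans (Nat.cast_le.2 (leftDeg_mono (fun e he => ?_) x)) (hl i (by omega) x)
        obtain ⟨h1, h2⟩ := Finset.mem_filter.1 he
        dsimp only at h2
        split_ifs at h2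
        · omega
        · exact Finset.mem_filter.2 ⟨h1, h2⟩
      · obtain rfl : i = j + 1 := by omega
        refine le_trans (Nat.cast_le.2 (leftDeg_mono (fun e he => ?_) x)) (hFl x)
        obtain ⟨h1, h2⟩ := Finset.mem_filter.1 he
        dsimp only at h2
        split_ifs at h2 with h3
        · exact h3
        · have := hlab e
          omega
    · rcases Nat.lt_or_ge i j with hij | hij
      · refine le_trans (Nat.cast_le.2 (Finset.card_le_card
          (Finset.filter_subset_filter _ fun e he => ?_))) (hr i hij y)
        obtain ⟨h1, h2⟩ := Finset.mem_filter.1 he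
        dsimp only at h2
        split_ifs at h2
        · omega
        · exact Finset.mem_filter.2 ⟨h1, h2⟩
      · obtain rfl : i = j := by omega
        refine le_trans (Nat.cast_le.2 (Finset.card_le_card
          (Finset.filter_subset_filter _ fun e he => ?_))) ((hFr y).trans ?_)
        · obtain ⟨h1, h2⟩ := Finset.mem_filter.1 he
          dsimp only at h2
          split_ifs at h2 with h3
          · omega
          · by_contra h4
            exact h3 (Finset.mem_sdiff.2 ⟨Finset.mem_filter.2 ⟨h1, h2⟩, h4⟩)
        · rw [mul_assoc]
          refine mul_le_mul_of_nonneg_left (mul_le_mul_of_nonneg_right ?_ (by positivity))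
            (by positivity)
          exact div_le_self hρ0.le hf

/-- Large admissible graphs have a skew-biregular decomposition. -/
theorem IsAdmissible.exists_decomposition {E : Finset (L × R)} (hE : IsAdmissible E) {K M : ℝ}
    (hK : 16 ≤ K) (hM : 2 ≤ M) (hn : 2 ≤ Real.logb 2 (order L R : ℝ))
    (hKn : K < order L R) :
    ∃ (h : ℕ) (cls : L × R → Fin h), IsSkewDecomposition E K M cls := by
  set Λ := Real.logb 2 (order L R : ℝ) with hΛ
  have hΛΛ : 1 ≤ Real.logb 2 Λ := by
    rw [Real.le_logb_iff_rpow_le one_lt_two (by linarith)]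
    simpa using hn
  have hpos : 0 < M * Real.logb 2 Λ := by nlinarith
  set h := ⌊M * Real.logb 2 Λ⌋₊ with hh
  have hh0 : 0 < h := Nat.floor_pos.2 (by nlinarith)
  obtain ⟨lab, hlab, hl, hr⟩ := hE.exists_labelling (hn := by linarith) hK h
  have hn0 : (0 : ℝ) < order L R := by linarith
  -- Since `h + 1 ≥ M log Λ` and `M ≥ 2`, the exponent satisfies `2 ^ (h + 1) ≥ Λ² ≥ 2 Λ`.
  have hbig : (order L R : ℝ) * order L R ≤ 2 ^ 2 ^ (h + 1) := by
    have h1 : M * Real.logb 2 Λ ≤ ((h + 1 : ℕ) : ℝ) := by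
      push_cast
      exact (Nat.lt_floor_add_one _).le
    have h2 : Λ ^ 2 ≤ (2 : ℝ) ^ (h + 1) := by
      rw [← Real.rpow_natCast 2 (h + 1)]
      refine le_trans ?_ (Real.rpow_le_rpow_of_exponent_le one_le_two h1)
      rw [mul_comm, Real.rpow_mul zero_le_two, Real.rpow_logb two_pos (by norm_num) (by linarith),
        ← Real.rpow_two]
      exact Real.rpow_le_rpow_of_exponent_le (by linarith) hM
    have h3 : (order L R : ℝ) = 2 ^ Λ := (Real.rpow_logb two_pos (by norm_num) hn0).symm
    rw [h3, ← Real.rpow_add two_pos, ← Real.rpow_natCast 2 (2 ^ (h + 1))]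
    refine Real.rpow_le_rpow_of_exponent_le one_le_two ?_
    push_cast
    nlinarith
  have hlast : ∀ e ∈ E, lab e < h := by
    intro e he
    -- An edge with label `h` would force `1 ≤ K ρ* / n²`, contradicting `ρ* ≤ n` and `K < n`. So
    -- the labels `0, …, h - 1` already cover `E`.
    refine lt_of_le_of_ne (hlab e) fun heq => ?_
    have h1 := hl h le_rfl e.1
    have h2 : 1 ≤ leftDeg (E.filter fun e => lab e = h) e.1 :=
      Finset.card_pos.2 ⟨e, Finset.mem_filter.2 ⟨Finset.mem_filter.2 ⟨he, heq⟩, rfl⟩⟩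
    have h3 : (1 : ℝ) ≤ K * (maxDensity E / 2 ^ 2 ^ (h + 1)) := le_trans (by exact_mod_cast h2) h1
    rw [← mul_div_assoc, one_le_div (by positivity)] at h3
    have h4 := maxDensity_le_order E
    nlinarith
  -- The default class 0 is only taken off `E`, so it does not affect any `edgeClass`.
  refine ⟨h, fun e => if he : lab e < h then ⟨lab e, he⟩ else ⟨0, hh0⟩, Nat.floor_le hpos.le,
    fun i => ?_⟩
  have hcls : edgeClass E (fun e => if he : lab e < h then ⟨lab e, he⟩ else ⟨0, hh0⟩) i =
      E.filter fun e => lab e = i := by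
    refine Finset.filter_congr fun e he => ?_
    dsimp only
    rw [dif_pos (hlast e he), Fin.ext_iff]
  rw [hcls]
  exact ⟨Finset.filter_subset _ _, hl i i.2.le, hr i i.2⟩

/-! ### Probability estimates for the arrivals -/

theorem measureReal_exists_le {Ω ι : Type*} [MeasurableSpace Ω] (μ : Measure Ω)
    (s : Finset ι) (P : ι → Ω → Prop) (f : ι → ℝ)
    (h : ∀ i ∈ s, μ.real {ω | P i ω} ≤ f i) :
    μ.real {ω | ∃ i ∈ s, P i ω} ≤ ∑ i ∈ s, f i := by
  have : {ω | ∃ i ∈ s, P i ω} = ⋃ i ∈ s, {ω | P i ω} := by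
    ext ω
    simp
  rw [this]
  exact (measureReal_biUnion_finset_le s _).trans (Finset.sum_le_sum h)

instance isProbabilityMeasure_arrivals (E : Finset (L × R)) [Nonempty (Edge E)] (n : ℕ) :
    IsProbabilityMeasure (arrivals E n) := by
  have : IsProbabilityMeasure (uniformOn (Set.univ : Set (Edge E))) :=
    isProbabilityMeasure_uniformOn Set.finite_univ Set.univ_nonempty
  unfold arrivals
  infer_instance

theorem nonempty_edge {E : Finset (L × R)} (hE : E.Nonempty) : Nonempty (Edge E) :=
  let ⟨e, he⟩ := hE
  ⟨⟨e, he⟩⟩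

theorem uniformOn_edge_real {E : Finset (L × R)} (S : Set (Edge E)) :
    (uniformOn (Set.univ : Set (Edge E))).real S = S.ncard / E.card := by
  have hS : S.Finite := Set.toFinite S
  have hc : Fintype.card (Edge E) = E.card := Fintype.card_coe E
  rw [Measure.real, uniformOn_univ, Measure.count_apply_finite _ hS, hc, ENNReal.toReal_div,
    ENNReal.toReal_natCast, ENNReal.toReal_natCast, Set.ncard_eq_toFinset_card _ hS]

/-- The arrival sequence `w` has the prescribed edges at the prescribed times. -/
def Matches {n : ℕ} (w : Fin n → L × R) (g : Finset (Fin n × (L × R))) : Prop :=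
  ∀ p ∈ g, w p.1 = p.2

/-- The event is a product over times. A time with one prescribed edge contributes at most `1 /
|E|`; a time with two different prescribed edges makes the event impossible, so `g` need not be
consistent. -/
theorem prob_matches_le {E : Finset (L × R)} (hE : E.Nonempty) {n : ℕ}
    (g : Finset (Fin n × (L × R))) :
    (arrivals E n).real {ω | Matches (fun t => (ω t).val) g} ≤ (1 / (E.card : ℝ)) ^ g.card := by
  have := nonempty_edge hE
  have hpr : IsProbabilityMeasure (uniformOn (Set.univ : Set (Edge E))) :=
    isProbabilityMeasure_uniformOn Set.finite_univ Set.univ_nonempty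
  have hset : {ω : Fin n → Edge E | Matches (fun t => (ω t).val) g} =
      Set.pi Set.univ fun t => {e : Edge E | ∀ p ∈ g, p.1 = t → e.val = p.2} := by
    ext ω
    simp only [Matches, Set.mem_ofPred_eq, Set.mem_pi, Set.mem_univ, forall_true_left]
    constructor
    · rintro h t p hp rfl
      exact h p hp
    · exact fun h p hp => h p.1 p hp rfl
  rw [hset, Measure.real, arrivals, Measure.pi_pi, ENNReal.toReal_prod,
    Finset.card_eq_sum_card_fiberwise (s := g) (f := Prod.fst) (t := Finset.univ)
      (fun _ _ => Finset.mem_coe.2 (Finset.mem_univ _)), ← Finset.prod_pow_eq_pow_sum]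
  refine Finset.prod_le_prod (fun _ _ => ENNReal.toReal_nonneg) fun t _ => ?_
  change (uniformOn (Set.univ : Set (Edge E))).real _ ≤ _
  rcases Nat.lt_trichotomy (g.filter fun p => p.1 = t).card 1 with h | h | h
  · rw [Nat.lt_one_iff] at h
    rw [h, pow_zero]
    exact measureReal_le_one
  · rw [h, pow_one, uniformOn_edge_real]
    refine div_le_div_of_nonneg_right ?_ (Nat.cast_nonneg _)
    obtain ⟨p, hp⟩ := Finset.card_eq_one.1 h
    have hpg : p ∈ g.filter fun p => p.1 = t := hp ▸ Finset.mem_singleton_self p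
    rw [Finset.mem_filter] at hpg
    rw [Nat.cast_le_one]
    refine (Set.ncard_le_one (Set.toFinite _)).2 fun e he e' he' => Subtype.ext ?_
    exact (he p hpg.1 hpg.2).trans (he' p hpg.1 hpg.2).symm
  · obtain ⟨p, hp, p', hp', hne⟩ := Finset.one_lt_card.1 h
    rw [Finset.mem_filter] at hp hp'
    have hemp : {e : Edge E | ∀ p ∈ g, p.1 = t → e.val = p.2} = ∅ := by
      refine Set.eq_empty_of_forall_notMem fun e he => hne (Prod.ext (hp.2.trans hp'.2.symm) ?_)
      exact (he p hp.1 hp.2).symm.trans (he p' hp'.1 hp'.2)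
    rw [hemp, measureReal_empty]
    positivity

/-! ### Union bound over explorations by extensions and links -/

/-- The left vertices occurring in a set of timed edges. -/
def leftVerts {n : ℕ} (g : Finset (Fin n × (L × R))) : Finset L :=
  g.image fun p => p.2.1

/-- The timed edges of class `i` at the left vertex `x`. -/
def timedStar (E : Finset (L × R)) {h : ℕ} (cls : L × R → Fin h) (n : ℕ) (i : Fin h) (x : L) :
    Finset (Fin n × (L × R)) :=
  Finset.univ ×ˢ (edgeClass E cls i).filter fun e => e.1 = x

theorem card_timedStar (E : Finset (L × R)) {h : ℕ} (cls : L × R → Fin h) (n : ℕ) (i : Fin h)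
    (x : L) : (timedStar E cls n i x).card = n * leftDeg (edgeClass E cls i) x := by
  rw [timedStar, Finset.card_product, Finset.card_univ, Fintype.card_fin, leftDeg]

/-- `g'` arises from `g` by adding an edge of some class `i` from `y` to a new left vertex `x`
together with `a i` further edges of class `i` at `x`. -/
def Extends (E : Finset (L × R)) {h : ℕ} (cls : L × R → Fin h) (a : Fin h → ℕ) (D : ℕ) {n : ℕ}
    (g : Finset (Fin n × (L × R))) (y : R) (g' : Finset (Fin n × (L × R))) : Prop :=
  ∃ i, a i ≤ D ∧ ∃ x, (x, y) ∈ edgeClass E cls i ∧ x ∉ leftVerts g ∧ ∃ s : Fin n,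
    ∃ T ∈ (timedStar E cls n i x).powersetCard (a i), (s, (x, y)) ∉ T ∧
      g' = g ∪ insert (s, (x, y)) T

theorem leftVerts_union {n : ℕ} (g g' : Finset (Fin n × (L × R))) :
    leftVerts (g ∪ g') = leftVerts g ∪ leftVerts g' :=
  Finset.image_union _ _

theorem leftVerts_insert_star {E : Finset (L × R)} {h n : ℕ} {cls : L × R → Fin h} {i : Fin h}
    {x : L} {y : R} {s : Fin n} {T : Finset (Fin n × (L × R))}
    (hT : T ⊆ timedStar E cls n i x) : leftVerts (insert (s, (x, y)) T) = {x} := by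
  ext z
  simp only [leftVerts, Finset.mem_image, Finset.mem_insert, Finset.mem_singleton]
  constructor
  · rintro ⟨p, rfl | hp, rfl⟩
    · rfl
    · exact (Finset.mem_filter.1 (Finset.mem_product.1 (hT hp)).2).2
  · rintro rfl
    exact ⟨_, Or.inl rfl, rfl⟩

/-- The star sits at a left vertex not in `g`, so it is disjoint from `g`. Every extension thus
brings the full factor `(1 / |E|) ^ (1 + a i)` of fresh randomness. -/
theorem card_union_star {E : Finset (L × R)} {h n : ℕ} {cls : L × R → Fin h} {i : Fin h}
    {x : L} {y : R} {s : Fin n} {g T : Finset (Fin n × (L × R))}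
    (hT : T ⊆ timedStar E cls n i x) (hx : x ∉ leftVerts g) (hs : (s, (x, y)) ∉ T) :
    (g ∪ insert (s, (x, y)) T).card = g.card + (1 + T.card) := by
  rw [Finset.card_union_of_disjoint, Finset.card_insert_of_notMem hs, add_comm T.card]
  refine Finset.disjoint_left.2 fun p hp hp' => hx ?_
  have h1 : p.2.1 ∈ leftVerts (insert (s, (x, y)) T) := Finset.mem_image_of_mem _ hp'
  rw [leftVerts_insert_star hT, Finset.mem_singleton] at h1
  exact h1 ▸ Finset.mem_image_of_mem _ hp

/-- The expected number of ways to extend a set of timed edges at the right vertex `y`. -/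
noncomputable def extensionWeight (E : Finset (L × R)) {h : ℕ} (cls : L × R → Fin h)
    (a : Fin h → ℕ) (D n : ℕ)
    (y : R) : ℝ :=
  ∑ i with a i ≤ D, ∑ e ∈ edgeClass E cls i with e.2 = y,
    n * ((n * leftDeg (edgeClass E cls i) e.1).choose (a i) * (1 / (E.card : ℝ)) ^ (1 + a i))

/-- A union bound over the class, the edge at `y`, its arrival time and the star. `Q` stands for the
rest of the exploration; a bound for it proportional to `(1 / |E|) ^ |g'|` is passed back to `g` in
the same form, which lets the estimate be iterated. -/
theorem prob_extends_le {E : Finset (L × R)} (hE : E.Nonempty) {h : ℕ} (cls : L × R → Fin h)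
    (a : Fin h → ℕ) (D : ℕ) {n : ℕ} (g : Finset (Fin n × (L × R))) (y : R) {C : ℝ} (hC : 0 ≤ C)
    (Q : Finset (Fin n × (L × R)) → (Fin n → Edge E) → Prop)
    (hQ : ∀ g', Extends E cls a D g y g' →
      (arrivals E n).real {ω | Q g' ω} ≤ C * (1 / (E.card : ℝ)) ^ g'.card) :
    (arrivals E n).real {ω | ∃ g', Extends E cls a D g y g' ∧ Q g' ω} ≤
      C * (1 / (E.card : ℝ)) ^ g.card * extensionWeight E cls a D n y := by
  have := nonempty_edge hE
  set q : ℝ := 1 / (E.card : ℝ) with hq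
  have hq0 : 0 ≤ q := by positivity
  have hsub : {ω | ∃ g', Extends E cls a D g y g' ∧ Q g' ω} ⊆
      {ω | ∃ i ∈ Finset.univ.filter fun i => a i ≤ D,
        ∃ e ∈ (edgeClass E cls i).filter fun e => e.2 = y, ∃ s ∈ (Finset.univ : Finset (Fin n)),
        ∃ T ∈ (timedStar E cls n i e.1).powersetCard (a i),
          (e.1 ∉ leftVerts g ∧ (s, (e.1, y)) ∉ T) ∧ Q (g ∪ insert (s, (e.1, y)) T) ω} := by
    rintro ω ⟨g', ⟨i, hi, x, hxy, hx, s, T, hT, hs, rfl⟩, hQω⟩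
    exact ⟨i, Finset.mem_filter.2 ⟨Finset.mem_univ i, hi⟩, (x, y),
      Finset.mem_filter.2 ⟨hxy, rfl⟩, s, Finset.mem_univ s, T, hT, ⟨hx, hs⟩, hQω⟩
  refine (measureReal_mono hsub).trans ?_
  rw [extensionWeight, Finset.mul_sum]
  refine measureReal_exists_le _ _ _ _ fun i hi => ?_
  rw [Finset.mul_sum]
  refine measureReal_exists_le _ _ _ _ fun e he => ?_
  obtain ⟨he1, he2⟩ := Finset.mem_filter.1 he
  have hn : C * q ^ g.card * (n * ((n * leftDeg (edgeClass E cls i) e.1).choose (a i) *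
      q ^ (1 + a i))) = ∑ _s : Fin n, ∑ _T ∈ (timedStar E cls n i e.1).powersetCard (a i),
        C * q ^ (g.card + (1 + a i)) := by
    rw [Finset.sum_const, Finset.sum_const, Finset.card_powersetCard, card_timedStar,
      Finset.card_univ, Fintype.card_fin, nsmul_eq_mul, nsmul_eq_mul, pow_add]
    ring
  rw [hn]
  refine measureReal_exists_le _ _ _ _ fun s _ => measureReal_exists_le _ _ _ _ fun T hT => ?_
  obtain ⟨hT1, hT2⟩ := Finset.mem_powersetCard.1 hT
  by_cases hc : e.1 ∉ leftVerts g ∧ (s, (e.1, y)) ∉ T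
  · simp only [hc, not_false_eq_true, and_self, true_and]
    rw [← hT2, ← card_union_star hT1 hc.1 hc.2]
    exact hQ _ ⟨i, (Finset.mem_filter.1 hi).2, e.1, he2 ▸ he1, hc.1, s, T, hT, hc.2, rfl⟩
  · simp only [hc, false_and, Set.ofPred_false, measureReal_empty]
    positivity

/-- A link either reuses a timed edge of `g`, with at most `|g|` choices and no gain in probability,
or is a new arrival at a left vertex of `g`, whose many choices are offset by a factor `1 / |E|`. -/
theorem prob_link_le {E : Finset (L × R)} (hE : E.Nonempty) {n : ℕ}
    (g : Finset (Fin n × (L × R))) {C : ℝ} (hC : 0 ≤ C) {Δ : ℝ}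
    (hΔ : ∀ x, (leftDeg E x : ℝ) ≤ Δ)
    (Q : Fin n × (L × R) → (Fin n → Edge E) → Prop)
    (hQ : ∀ p, p.2.1 ∈ leftVerts g →
      (arrivals E n).real {ω | Q p ω} ≤ C * (1 / (E.card : ℝ)) ^ (insert p g).card) :
    (arrivals E n).real {ω | ∃ p, (p.2 ∈ E ∧ p.2.1 ∈ leftVerts g) ∧ Q p ω} ≤
      C * (1 / (E.card : ℝ)) ^ g.card *
        (g.card + n * ((leftVerts g).card * Δ) * (1 / (E.card : ℝ))) := by
  have := nonempty_edge hE
  set q : ℝ := 1 / (E.card : ℝ) with hq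
  have hq0 : 0 ≤ q := by positivity
  set S : Finset (Fin n × (L × R)) :=
    Finset.univ ×ˢ E.filter fun e => e.1 ∈ leftVerts g with hS
  have hsub : {ω | ∃ p, (p.2 ∈ E ∧ p.2.1 ∈ leftVerts g) ∧ Q p ω} ⊆ {ω | ∃ p ∈ S, Q p ω} := by
    rintro ω ⟨p, hp, hQω⟩
    exact ⟨p, Finset.mem_product.2 ⟨Finset.mem_univ _, Finset.mem_filter.2 hp⟩, hQω⟩
  refine (measureReal_mono hsub).trans ?_
  refine (measureReal_exists_le _ S _ (fun p => C * q ^ (insert p g).card) fun p hp =>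
    hQ p (Finset.mem_filter.1 (Finset.mem_product.1 hp).2).2).trans ?_
  have hle : ∀ p ∈ S, C * q ^ (insert p g).card ≤
      (if p ∈ g then C * q ^ g.card else 0) + C * q ^ (g.card + 1) := fun p _ => by
    split_ifs with hp
    · rw [Finset.insert_eq_of_mem hp]
      exact le_add_of_nonneg_right (by positivity)
    · rw [Finset.card_insert_of_notMem hp, zero_add]
  refine (Finset.sum_le_sum hle).trans ?_
  rw [Finset.sum_add_distrib, ← Finset.sum_filter, Finset.sum_const, Finset.sum_const,
    nsmul_eq_mul, nsmul_eq_mul]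
  have h1 : ((S.filter fun p => p ∈ g).card : ℝ) ≤ g.card :=
    Nat.cast_le.2 (Finset.card_le_card fun p hp => (Finset.mem_filter.1 hp).2)
  have h2 : (S.card : ℝ) ≤ n * ((leftVerts g).card * Δ) := by
    rw [hS, Finset.card_product, Finset.card_univ, Fintype.card_fin, Nat.cast_mul]
    refine mul_le_mul_of_nonneg_left ?_ (Nat.cast_nonneg _)
    rw [Finset.card_eq_sum_card_fiberwise (s := E.filter fun e => e.1 ∈ leftVerts g)
      (f := Prod.fst) (t := leftVerts g) (fun e he => (Finset.mem_filter.1 (Finset.mem_coe.1 he)).2),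
      Nat.cast_sum, ← nsmul_eq_mul, ← Finset.sum_const]
    exact Finset.sum_le_sum fun x _ => le_trans
      (Nat.cast_le.2 (leftDeg_mono (Finset.filter_subset _ _) x)) (hΔ x)
  calc ((S.filter fun p => p ∈ g).card : ℝ) * (C * q ^ g.card) + S.card * (C * q ^ (g.card + 1))
      ≤ g.card * (C * q ^ g.card) + n * ((leftVerts g).card * Δ) * (C * q ^ (g.card + 1)) := by
        gcongr
    _ = _ := by rw [pow_succ]; ring

/-- `Chain E cls a D j g y w`: the arrivals `w` match `g`, and starting at the right vertex `y`,
one can discover `j` further left vertices, each with many arrivals of one class. -/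
def Chain (E : Finset (L × R)) {h : ℕ} (cls : L × R → Fin h) (a : Fin h → ℕ) (D : ℕ) {n : ℕ} :
    ℕ → Finset (Fin n × (L × R)) → R → (Fin n → L × R) → Prop
  | 0, g, _, w => Matches w g
  | j + 1, g, y, w => ∃ g', Extends E cls a D g y g' ∧
      ∃ p, (p.2 ∈ E ∧ p.2.1 ∈ leftVerts g') ∧ Chain E cls a D j (insert p g') p.2.2 w

theorem leftVerts_insert_of_mem {n : ℕ} {g : Finset (Fin n × (L × R))} {p : Fin n × (L × R)}
    (hp : p.2.1 ∈ leftVerts g) : leftVerts (insert p g) = leftVerts g := by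
  rw [leftVerts, Finset.image_insert]
  exact Finset.insert_eq_of_mem hp

/-- Each stage costs `β` for the extension and the second factor for the link. The budgets `hl` and
`hg` keep that factor uniform: a stage adds at most one left vertex and at most `D + 2` timed edges,
namely the new edge, a star of size at most `D`, and the link. -/
theorem prob_chain_le {E : Finset (L × R)} (hE : E.Nonempty) {h : ℕ} (cls : L × R → Fin h)
    (a : Fin h → ℕ) (D m n : ℕ) {β Δ : ℝ} (hβ0 : 0 ≤ β)
    (hβ : ∀ y, extensionWeight E cls a D n y ≤ β) (hΔ0 : 0 ≤ Δ)
    (hΔ : ∀ x, (leftDeg E x : ℝ) ≤ Δ) (j : ℕ) (g : Finset (Fin n × (L × R))) (y : R)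
    (hl : (leftVerts g).card + j ≤ m) (hg : g.card + j * (D + 2) ≤ m * (D + 2)) :
    (arrivals E n).real {ω | Chain E cls a D j g y fun t => (ω t).val} ≤
      (β * (m * (D + 2) + n * (m * Δ) * (1 / (E.card : ℝ)))) ^ j *
        (1 / (E.card : ℝ)) ^ g.card := by
  induction j generalizing g y with
  | zero =>
    simp only [Chain, pow_zero, one_mul]
    exact prob_matches_le hE g
  | succ j ih =>
    set q : ℝ := 1 / (E.card : ℝ) with hq
    have hq0 : 0 ≤ q := by positivity
    set γ : ℝ := m * (D + 2) + n * (m * Δ) * q with hγ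
    have hγ0 : 0 ≤ γ := by positivity
    have key := prob_extends_le hE cls a D g y (C := (β * γ) ^ j * γ) (by positivity)
      (fun g' ω => ∃ p, (p.2 ∈ E ∧ p.2.1 ∈ leftVerts g') ∧
        Chain E cls a D j (insert p g') p.2.2 fun t => (ω t).val) (fun g' hg' => by
      obtain ⟨i, hi, x, -, hx, s, T, hT, hs, rfl⟩ := hg'
      obtain ⟨hT1, hT2⟩ := Finset.mem_powersetCard.1 hT
      set g' := g ∪ insert (s, (x, y)) T with hg'
      have hcard : g'.card = g.card + (1 + a i) := by
        rw [hg', card_union_star hT1 hx hs, hT2]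
      have hlv : (leftVerts g').card ≤ (leftVerts g).card + 1 := by
        rw [hg', leftVerts_union, leftVerts_insert_star hT1]
        exact Finset.card_union_le _ _
      have hgm : (j + 1) * (D + 2) = j * (D + 2) + D + 2 := by ring
      refine (prob_link_le hE g' (C := (β * γ) ^ j) (by positivity) hΔ _ fun p hp => ?_).trans ?_
      · refine ih _ _ ?_ ?_
        · rw [leftVerts_insert_of_mem hp]
          omega
        · have := Finset.card_insert_le p g'
          omega
      · rw [mul_right_comm]
        refine mul_le_mul_of_nonneg_right (mul_le_mul_of_nonneg_left ?_ (by positivity))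
          (by positivity)
        have h1 : (g'.card : ℝ) ≤ m * (D + 2) := by
          have : g'.card ≤ m * (D + 2) := by omega
          exact_mod_cast this
        have h2 : ((leftVerts g').card : ℝ) ≤ m := Nat.cast_le.2 (by omega)
        rw [hγ]
        gcongr)
    refine key.trans ?_
    calc (β * γ) ^ j * γ * q ^ g.card * extensionWeight E cls a D n y
        ≤ (β * γ) ^ j * γ * q ^ g.card * β := mul_le_mul_of_nonneg_left (hβ y) (by positivity)
      _ = _ := by ring

/-- The number of arrivals at the left vertex `x`. -/
def arrivalDeg {n : ℕ} (w : Fin n → L × R) (x : L) : ℕ :=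
  (Finset.univ.filter fun t => (w t).1 = x).card

/-- A union bound over the sets of `D` timed edges at `x`. -/
theorem prob_arrivalDeg_le {E : Finset (L × R)} (hE : E.Nonempty) (n D : ℕ) (x : L) :
    (arrivals E n).real {ω | D ≤ arrivalDeg (fun t => (ω t).val) x} ≤
      (n * leftDeg E x).choose D * (1 / (E.card : ℝ)) ^ D := by
  have := nonempty_edge hE
  set S : Finset (Fin n × (L × R)) := Finset.univ ×ˢ E.filter fun e => e.1 = x with hS
  have hsub : {ω : Fin n → Edge E | D ≤ arrivalDeg (fun t => (ω t).val) x} ⊆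
      {ω | ∃ T ∈ S.powersetCard D, Matches (fun t => (ω t).val) T} := by
    intro ω hω
    obtain ⟨T, hT, hTc⟩ := Finset.exists_subset_card_eq hω
    refine ⟨T.image fun t => (t, (ω t).val), Finset.mem_powersetCard.2 ⟨?_, ?_⟩, ?_⟩
    · intro p hp
      obtain ⟨t, ht, rfl⟩ := Finset.mem_image.1 hp
      exact Finset.mem_product.2 ⟨Finset.mem_univ _,
        Finset.mem_filter.2 ⟨(ω t).2, (Finset.mem_filter.1 (hT ht)).2⟩⟩
    · rw [Finset.card_image_of_injective _ fun t t' h => (Prod.ext_iff.1 h).1, hTc]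
    · intro p hp
      obtain ⟨t, ht, rfl⟩ := Finset.mem_image.1 hp
      rfl
  refine (measureReal_mono hsub).trans ?_
  refine (measureReal_exists_le _ _ _ (fun _ => (1 / (E.card : ℝ)) ^ D) fun T hT => ?_).trans ?_
  · rw [← (Finset.mem_powersetCard.1 hT).2]
    exact prob_matches_le hE T
  · rw [Finset.sum_const, Finset.card_powersetCard, nsmul_eq_mul, hS, Finset.card_product,
      Finset.card_univ, Fintype.card_fin, leftDeg]

/-! ### Components of the greedy graph -/

theorem update_bump_le {X ι : Type*} [DecidableEq X] [DecidableEq ι] (f : X → ι → ℕ) (x₀ x : X)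
    (i₀ i : ι) [Decidable (x₀ = x ∧ i₀ = i)] :
    Function.update f x₀ (bump (f x₀) i₀) x i ≤ f x i + if x₀ = x ∧ i₀ = i then 1 else 0 := by
  by_cases hx : x₀ = x
  · subst hx
    rw [Function.update_self, bump]
    by_cases hi : i₀ = i
    · subst hi
      simp
    · rw [Function.update_of_ne (Ne.symm hi)]
      exact Nat.le_add_right _ _
  · rw [Function.update_of_ne (Ne.symm hx)]
    exact Nat.le_add_right _ _

theorem classLoad_step_le {h : ℕ} (α : Fin h → ℝ) (cls : L × R → Fin h) (s : State L R h)
    (e : L × R) (x : L) (i : Fin h) :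
    (step α cls s e).classLoad x i ≤
      s.classLoad x i + if e.1 = x ∧ cls e = i then 1 else 0 := by
  unfold step
  by_cases h1 : IsThreshold α cls s e
  · rw [if_pos h1]
    dsimp only
    convert update_bump_le s.classLoad e.1 x (cls e) i
  rw [if_neg h1]
  by_cases h2 : s.greedyLoad (Sum.inl e.1) < s.greedyLoad (Sum.inr e.2)
  · rw [if_pos h2]
    dsimp only
    convert update_bump_le s.classLoad e.1 x (cls e) i
  · rw [if_neg h2]
    exact Nat.le_add_right _ _

/-- The load due to a class is at most the number of arrivals of that class. -/
theorem classLoad_stateAt_le {h n : ℕ} (α : Fin h → ℝ) (cls : L × R → Fin h)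
    (w : Fin n → L × R) (x : L) (i : Fin h) (t : ℕ) :
    (stateAt α cls w t).classLoad x i ≤
      (Finset.univ.filter fun t' : Fin n =>
        (t' : ℕ) < t ∧ (w t').1 = x ∧ cls (w t') = i).card := by
  induction t with
  | zero => exact Nat.zero_le _
  | succ t ih =>
    rw [stateAt]
    split_ifs with ht
    · refine (classLoad_step_le α cls _ _ x i).trans ?_
      split_ifs with hc
      · refine (Nat.add_le_add_right ih 1).trans ?_
        rw [← Finset.card_insert_of_notMem (a := (⟨t, ht⟩ : Fin n)) (by simp)]
        refine Finset.card_le_card fun t' ht' => ?_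
        rcases Finset.mem_insert.1 ht' with rfl | ht'
        · exact Finset.mem_filter.2 ⟨Finset.mem_univ _, Nat.lt_succ_self t, hc⟩
        · obtain ⟨-, h1, h2⟩ := Finset.mem_filter.1 ht'
          exact Finset.mem_filter.2 ⟨Finset.mem_univ _, h1.trans (Nat.lt_succ_self t), h2⟩
      · exact ih.trans (Finset.card_le_card fun t' ht' => by
          obtain ⟨-, h1, h2⟩ := Finset.mem_filter.1 ht'
          exact Finset.mem_filter.2 ⟨Finset.mem_univ _, h1.trans (Nat.lt_succ_self t), h2⟩)
    · exact ih.trans (Finset.card_le_card fun t' ht' => by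
        obtain ⟨-, h1, h2⟩ := Finset.mem_filter.1 ht'
        exact Finset.mem_filter.2 ⟨Finset.mem_univ _, h1.trans (Nat.lt_succ_self t), h2⟩)

/-- A greedy edge is preceded by many arrivals of its class at its left endpoint. -/
theorem ceil_le_card_of_not_isThreshold {h n : ℕ} {α : Fin h → ℝ} {cls : L × R → Fin h}
    {w : Fin n → L × R} {t : Fin n} (ht : ¬ IsThreshold α cls (stateAt α cls w t) (w t)) :
    ⌈α (cls (w t))⌉₊ ≤ (Finset.univ.filter fun t' : Fin n =>
        (t' : ℕ) < t ∧ (w t').1 = (w t).1 ∧ cls (w t') = cls (w t)).card :=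
  (Nat.ceil_le.2 (not_lt.1 ht)).trans (classLoad_stateAt_le α cls w _ _ t)

/-- Supplies the condition `a i ≤ D` in `Extends`, which caps the size of the stars. -/
theorem ceil_le_arrivalDeg {h n : ℕ} {α : Fin h → ℝ} {cls : L × R → Fin h}
    {w : Fin n → L × R} {t : Fin n} (ht : ¬ IsThreshold α cls (stateAt α cls w t) (w t)) :
    ⌈α (cls (w t))⌉₊ ≤ arrivalDeg w (w t).1 :=
  (ceil_le_card_of_not_isThreshold ht).trans (Finset.card_le_card fun _ ht' =>
    Finset.mem_filter.2 ⟨Finset.mem_univ _, (Finset.mem_filter.1 ht').2.2.1⟩)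

/-- The arrivals forming the star are strictly earlier than `t`, so the greedy edge itself is an
additional timed edge. -/
theorem exists_star_of_not_isThreshold {E : Finset (L × R)} {h n : ℕ} {α : Fin h → ℝ}
    {cls : L × R → Fin h} {w : Fin n → L × R} (hw : ∀ t, w t ∈ E) {t : Fin n}
    (ht : ¬ IsThreshold α cls (stateAt α cls w t) (w t)) :
    ∃ T ∈ (timedStar E cls n (cls (w t)) (w t).1).powersetCard ⌈α (cls (w t))⌉₊,
      (t, w t) ∉ T ∧ Matches w T := by
  obtain ⟨T, hT, hTc⟩ := Finset.exists_subset_card_eq (ceil_le_card_of_not_isThreshold ht)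
  refine ⟨T.image fun t' => (t', w t'), Finset.mem_powersetCard.2 ⟨?_, ?_⟩, ?_, ?_⟩
  · intro p hp
    obtain ⟨t', ht', rfl⟩ := Finset.mem_image.1 hp
    obtain ⟨-, -, h1, h2⟩ := Finset.mem_filter.1 (hT ht')
    exact Finset.mem_product.2 ⟨Finset.mem_univ _,
      Finset.mem_filter.2 ⟨Finset.mem_filter.2 ⟨hw t', h2⟩, h1⟩⟩
  · rw [Finset.card_image_of_injective _ fun t t' h => (Prod.ext_iff.1 h).1, hTc]
  · intro hp
    obtain ⟨t', ht', he⟩ := Finset.mem_image.1 hp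
    obtain rfl : t' = t := (Prod.ext_iff.1 he).1
    exact lt_irrefl _ (Finset.mem_filter.1 (hT ht')).2.1
  · intro p hp
    obtain ⟨t', ht', rfl⟩ := Finset.mem_image.1 hp
    rfl

theorem greedyGraph_adj {h n : ℕ} {α : Fin h → ℝ} {cls : L × R → Fin h}
    {w : Fin n → L × R} {a b : L ⊕ R} :
    (greedyGraph α cls w).Adj a b ↔ ∃ t : Fin n, ¬ IsThreshold α cls (stateAt α cls w t) (w t) ∧
      ((a = Sum.inl (w t).1 ∧ b = Sum.inr (w t).2) ∨
        (a = Sum.inr (w t).2 ∧ b = Sum.inl (w t).1)) := by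
  rw [greedyGraph, SimpleGraph.fromEdgeSet_adj]
  simp only [Set.mem_ofPred_eq, Sym2.eq_iff]
  constructor
  · exact fun h => h.1
  · rintro ⟨t, ht, h⟩
    refine ⟨⟨t, ht, h⟩, ?_⟩
    rcases h with ⟨rfl, rfl⟩ | ⟨rfl, rfl⟩ <;> simp

theorem greedyGraph_adj_inl_inr {h n : ℕ} {α : Fin h → ℝ} {cls : L × R → Fin h}
    {w : Fin n → L × R} {x : L} {y : R} :
    (greedyGraph α cls w).Adj (Sum.inl x) (Sum.inr y) ↔
      ∃ t : Fin n, ¬ IsThreshold α cls (stateAt α cls w t) (w t) ∧ w t = (x, y) := by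
  rw [greedyGraph_adj]
  refine exists_congr fun t => and_congr_right fun _ => ?_
  simp only [Sum.inl.injEq, Sum.inr.injEq, reduceCtorEq, and_self, or_false, Prod.ext_iff]
  exact and_congr eq_comm eq_comm

open Classical in
/-- The left vertices of a connected component. -/
noncomputable def compLeft {G : SimpleGraph (L ⊕ R)} (κ : G.ConnectedComponent) : Finset L :=
  Finset.univ.filter fun x => Sum.inl x ∈ κ.supp

theorem mem_compLeft {G : SimpleGraph (L ⊕ R)} {κ : G.ConnectedComponent} {x : L} :
    x ∈ compLeft κ ↔ Sum.inl x ∈ κ.supp := by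
  simp [compLeft]

theorem reachable_of_mem_supp {V : Type*} {G : SimpleGraph V} {κ : G.ConnectedComponent} {a b : V}
    (ha : a ∈ κ.supp) (hb : b ∈ κ.supp) : G.Reachable a b :=
  SimpleGraph.ConnectedComponent.exact (ha.trans hb.symm)

theorem mem_supp_of_adj {V : Type*} {G : SimpleGraph V} {κ : G.ConnectedComponent} {a b : V}
    (ha : a ∈ κ.supp) (hab : G.Adj a b) : b ∈ κ.supp :=
  (SimpleGraph.ConnectedComponent.sound hab.reachable.symm).trans ha

/-- A proper nonempty part of the left vertices of a component is linked to the rest of them by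
a right vertex. -/
theorem exists_link {h n : ℕ} {α : Fin h → ℝ} {cls : L × R → Fin h} {w : Fin n → L × R}
    (κ : (greedyGraph α cls w).ConnectedComponent) (X : Finset L) (hX : X.Nonempty)
    (hXκ : X ⊆ compLeft κ) (hcard : X.card < (compLeft κ).card) :
    ∃ x ∈ X, ∃ y, ∃ x' ∉ X, (greedyGraph α cls w).Adj (Sum.inl x) (Sum.inr y) ∧
      (greedyGraph α cls w).Adj (Sum.inl x') (Sum.inr y) := by
  by_contra! hcon
  obtain ⟨x₀, hx₀⟩ := hX
  -- Invariant along walks from `x₀`: left vertices stay in `X`, and right vertices are adjacent to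
  -- `X`. Hence the whole component would have its left vertices in `X`.
  have key : ∀ b, (greedyGraph α cls w).Reachable (Sum.inl x₀) b →
      (∀ z, b = Sum.inl z → z ∈ X) ∧
      ∀ z, b = Sum.inr z → ∃ x ∈ X, (greedyGraph α cls w).Adj (Sum.inl x) (Sum.inr z) := by
    intro b hb
    rw [SimpleGraph.reachable_iff_reflTransGen] at hb
    induction hb with
    | refl =>
      refine ⟨fun z hz => ?_, fun z hz => by simp at hz⟩
      rw [← Sum.inl.inj hz]
      exact hx₀
    | tail _ hadj ih =>
      refine ⟨fun z hz => ?_, fun z hz => ?_⟩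
      · subst hz
        obtain ⟨t, -, ⟨-, h2⟩ | ⟨h1, -⟩⟩ := greedyGraph_adj.1 hadj
        · simp at h2
        · obtain ⟨x, hx, hxy⟩ := ih.2 _ h1
          by_contra hz
          rw [h1] at hadj
          exact hcon x hx _ z hz hxy hadj.symm
      · subst hz
        obtain ⟨t, -, ⟨h1, -⟩ | ⟨-, h2⟩⟩ := greedyGraph_adj.1 hadj
        · rw [h1] at hadj
          exact ⟨_, ih.1 _ h1, hadj⟩
        · simp at h2
  refine absurd (Finset.card_le_card fun z hz => ?_) (not_le.2 hcard)
  exact (key _ (reachable_of_mem_supp (mem_compLeft.1 (hXκ hx₀)) (mem_compLeft.1 hz))).1 z rfl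

/-- The exploration: `y` always has a greedy neighbour in the component outside the explored left
vertices. After that neighbour and its star are added, `exists_link` yields the next `y`, reached by
an arrival at an explored vertex. -/
theorem exists_chain_of_component {E : Finset (L × R)} {h n D : ℕ} {α : Fin h → ℝ}
    {cls : L × R → Fin h} {w : Fin n → L × R} (hw : ∀ t, w t ∈ E)
    (hD : ∀ x, arrivalDeg w x ≤ D) (κ : (greedyGraph α cls w).ConnectedComponent) (j : ℕ)
    (g : Finset (Fin n × (L × R))) (y : R) (hg : Matches w g) (hgκ : leftVerts g ⊆ compLeft κ)
    (hcard : (leftVerts g).card + j ≤ (compLeft κ).card)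
    (hy : 0 < j → ∃ x ∉ leftVerts g, x ∈ compLeft κ ∧
      (greedyGraph α cls w).Adj (Sum.inl x) (Sum.inr y)) :
    Chain E cls (fun i => ⌈α i⌉₊) D j g y w := by
  induction j generalizing g y with
  | zero => exact hg
  | succ j ih =>
    obtain ⟨x, hxg, hxκ, hadj⟩ := hy (Nat.succ_pos j)
    obtain ⟨s, hs, hsw⟩ := greedyGraph_adj_inl_inr.1 hadj
    obtain ⟨T, hT, hsT, hTw⟩ := exists_star_of_not_isThreshold hw hs
    have hsD := (ceil_le_arrivalDeg hs).trans (hD _)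
    have hsE := hw s
    rw [hsw] at hT hsT hsD hsE
    obtain ⟨hT1, hT2⟩ := Finset.mem_powersetCard.1 hT
    set g' := g ∪ insert (s, (x, y)) T with hg'
    have hlv : leftVerts g' = insert x (leftVerts g) := by
      rw [hg', leftVerts_union, leftVerts_insert_star hT1, Finset.union_comm]
      rfl
    have hg'w : Matches w g' := by
      intro p hp
      rcases Finset.mem_union.1 hp with hp | hp
      · exact hg p hp
      · rcases Finset.mem_insert.1 hp with rfl | hp
        · exact hsw
        · exact hTw p hp
    have hg'κ : leftVerts g' ⊆ compLeft κ := by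
      rw [hlv]
      exact Finset.insert_subset hxκ hgκ
    have hg'c : (leftVerts g').card = (leftVerts g).card + 1 := by
      rw [hlv, Finset.card_insert_of_notMem hxg]
    have hx' : x ∈ leftVerts g' := hlv ▸ Finset.mem_insert_self x _
    refine ⟨g', ⟨_, hsD, x, Finset.mem_filter.2 ⟨hsE, rfl⟩, hxg, s, T, hT, hsT, rfl⟩, ?_⟩
    obtain ⟨r, hr, hr', hnext⟩ : ∃ r : Fin n, w r ∈ E ∧ (w r).1 ∈ leftVerts g' ∧
        (0 < j → ∃ x ∉ leftVerts g', x ∈ compLeft κ ∧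
          (greedyGraph α cls w).Adj (Sum.inl x) (Sum.inr (w r).2)) := by
      -- After the last stage nothing remains to be discovered, but `Chain` still asks for a link;
      -- the edge just used serves.
      rcases Nat.eq_zero_or_pos j with rfl | hj
      · refine ⟨s, hw s, ?_, fun h => absurd h (lt_irrefl _)⟩
        rw [hsw]
        exact hx'
      · obtain ⟨x₁, hx₁, z, x₂, hx₂, h1, h2⟩ :=
          exists_link κ (leftVerts g') ⟨x, hx'⟩ hg'κ (by omega)
        obtain ⟨r, -, hrw⟩ := greedyGraph_adj_inl_inr.1 h1
        refine ⟨r, hw r, by rw [hrw]; exact hx₁, fun _ => ⟨x₂, hx₂, ?_, by rw [hrw]; exact h2⟩⟩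
        have hz := mem_supp_of_adj (mem_compLeft.1 (hg'κ hx₁)) h1
        exact mem_compLeft.2 (mem_supp_of_adj hz h2.symm)
    have hins : leftVerts (insert (r, w r) g') = leftVerts g' := leftVerts_insert_of_mem hr'
    refine ⟨(r, w r), ⟨hr, hr'⟩, ih _ _ ?_ ?_ ?_ ?_⟩
    · intro p hp
      rcases Finset.mem_insert.1 hp with rfl | hp
      · rfl
      · exact hg'w p hp
    · rw [hins]
      exact hg'κ
    · rw [hins]
      omega
    · rw [hins]
      exact hnext

/-- A component of the greedy graph with many left vertices contains a long chain. -/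
theorem exists_chain {E : Finset (L × R)} {h n D : ℕ} {α : Fin h → ℝ}
    {cls : L × R → Fin h} {w : Fin n → L × R} (hw : ∀ t, w t ∈ E)
    (hD : ∀ x, arrivalDeg w x ≤ D) (κ : (greedyGraph α cls w).ConnectedComponent) {m : ℕ}
    (hm : 2 ≤ m) (hκ : m ≤ (compLeft κ).card) :
    ∃ y, Chain E cls (fun i => ⌈α i⌉₊) D m ∅ y w := by
  obtain ⟨x₀, hx₀⟩ := Finset.card_pos.1 (show 0 < (compLeft κ).card by omega)
  obtain ⟨x, hx, y, -, -, hxy, -⟩ := exists_link κ {x₀} (Finset.singleton_nonempty _)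
    (Finset.singleton_subset_iff.2 hx₀) (by rw [Finset.card_singleton]; omega)
  rw [Finset.mem_singleton] at hx
  subst hx
  refine ⟨y, exists_chain_of_component hw hD κ m ∅ y (fun p hp => by simp at hp)
    (by simp [leftVerts]) (by simpa [leftVerts] using hκ) fun _ => ⟨x, by simp [leftVerts], hx₀, hxy⟩⟩

/-- A component with few left vertices is small if every left vertex has few arrivals. -/
theorem ncard_supp_le {h n D m : ℕ} {α : Fin h → ℝ} {cls : L × R → Fin h} {w : Fin n → L × R}
    (hD : ∀ x, arrivalDeg w x ≤ D) (κ : (greedyGraph α cls w).ConnectedComponent)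
    (hκ : (compLeft κ).card ≤ m) : κ.supp.ncard ≤ 1 + m * (D + 1) := by
  have hnbr : ∀ y b, Sum.inr y ∈ κ.supp → b ∈ κ.supp → b ≠ Sum.inr y →
      ∃ t : Fin n, (w t).1 ∈ compLeft κ ∧ (w t).2 = y := by
    intro y b hy hb hne
    have hr := reachable_of_mem_supp hy hb
    rw [SimpleGraph.reachable_iff_reflTransGen] at hr
    rcases Relation.ReflTransGen.cases_head hr with heq | ⟨c, hadj, -⟩
    · exact absurd heq.symm hne
    · have hc := mem_supp_of_adj hy hadj
      obtain ⟨t, -, ⟨h1, -⟩ | ⟨h1, h2⟩⟩ := greedyGraph_adj.1 hadj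
      · simp at h1
      · exact ⟨t, mem_compLeft.2 (h2 ▸ hc), (Sum.inr.inj h1).symm⟩
  -- A component may be a single isolated right vertex, which no arrival accounts for; hence the
  -- summand 1.
  by_cases hone : κ.supp.ncard ≤ 1
  · exact hone.trans (Nat.le_add_right _ _)
  obtain ⟨a, b, ha, hb, hab⟩ := (Set.one_lt_ncard_iff (Set.toFinite _)).1 (not_le.1 hone)
  classical
  have hsub : κ.supp ⊆ ((compLeft κ).image Sum.inl ∪
      ((compLeft κ).biUnion fun x => Finset.univ.filter fun t => (w t).1 = x).image
        (fun t => Sum.inr (w t).2) : Finset (L ⊕ R)) := by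
    rintro (x | y) hz
    · exact Finset.mem_coe.2 (Finset.mem_union_left _
        (Finset.mem_image_of_mem _ (mem_compLeft.2 hz)))
    · obtain ⟨t, ht, rfl⟩ : ∃ t : Fin n, (w t).1 ∈ compLeft κ ∧ (w t).2 = y := by
        by_cases hay : a = Sum.inr y
        · exact hnbr y b hz hb (hay ▸ hab.symm)
        · exact hnbr y a hz ha hay
      refine Finset.mem_coe.2 (Finset.mem_union_right _ (Finset.mem_image.2 ⟨t, ?_, rfl⟩))
      exact Finset.mem_biUnion.2 ⟨_, ht, Finset.mem_filter.2 ⟨Finset.mem_univ t, rfl⟩⟩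
  refine (Set.ncard_le_ncard hsub (Finset.finite_toSet _)).trans ?_
  rw [Set.ncard_coe_finset]
  refine (Finset.card_union_le _ _).trans ?_
  have h1 : ((compLeft κ).image (Sum.inl : L → L ⊕ R)).card ≤ m :=
    Finset.card_image_le.trans hκ
  have h2 : (((compLeft κ).biUnion fun x => Finset.univ.filter fun t => (w t).1 = x).image
        (fun t => (Sum.inr (w t).2 : L ⊕ R))).card ≤ m * D := by
    refine Finset.card_image_le.trans (Finset.card_biUnion_le.trans ?_)
    refine (Finset.sum_le_sum fun x _ => hD x).trans ?_
    rw [Finset.sum_const, smul_eq_mul]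
    exact Nat.mul_le_mul_right D hκ
  rw [Nat.mul_add]
  omega

/-! ### Numerical estimates -/

/-- A Chernoff-type tail bound: the binomial coefficient is at most `N ^ a / a!`, and `a! ≥ (a / 3)
^ a` because `e < 3`. -/
theorem choose_mul_pow_le {N a : ℕ} {q b : ℝ} (hq : 0 ≤ q) (h : 3 * (N * q) ≤ b * a) :
    (N.choose a : ℝ) * q ^ a ≤ b ^ a := by
  rcases Nat.eq_zero_or_pos a with rfl | ha
  · simp
  have ha' : (0 : ℝ) < a := Nat.cast_pos.2 ha
  have hb : 0 ≤ b := by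
    by_contra! hb
    have : 0 ≤ 3 * ((N : ℝ) * q) := by positivity
    nlinarith
  have hf : (0 : ℝ) < a.factorial := Nat.cast_pos.2 a.factorial_pos
  have h1 : (a : ℝ) ^ a ≤ 3 ^ a * a.factorial := by
    rw [← div_le_iff₀ hf]
    refine (Real.pow_div_factorial_le_exp (a : ℝ) ha'.le a).trans ?_
    rw [← mul_one (a : ℝ), Real.exp_nat_mul]
    exact pow_le_pow_left₀ (Real.exp_pos 1).le (by linarith [Real.exp_one_lt_d9]) a
  have h2 : (3 * ((N : ℝ) * q)) ^ a ≤ (b * a) ^ a := pow_le_pow_left₀ (by positivity) h a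
  rw [mul_pow, mul_pow b] at h2
  have h3 : (3 : ℝ) ^ a * (N * q) ^ a ≤ 3 ^ a * (b ^ a * a.factorial) := by
    refine h2.trans ((mul_le_mul_of_nonneg_left h1 (by positivity)).trans (le_of_eq (by ring)))
  have h4 := le_of_mul_le_mul_left h3 (by positivity)
  calc (N.choose a : ℝ) * q ^ a ≤ (N : ℝ) ^ a / a.factorial * q ^ a :=
        mul_le_mul_of_nonneg_right (Nat.choose_le_pow_div a N) (by positivity)
    _ = (N * q) ^ a / a.factorial := by rw [mul_pow]; ring
    _ ≤ b ^ a := by rwa [div_le_iff₀ hf]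

theorem order_div_card {E : Finset (L × R)} (hE : IsAdmissible E) :
    (order L R : ℝ) * (1 / (E.card : ℝ)) = 2 / avgDeg E := by
  have hd := hE.one_le_avgDeg
  unfold avgDeg at hd ⊢
  have hn : (order L R : ℝ) ≠ 0 := by
    intro h
    rw [h, div_zero] at hd
    linarith
  have hc : (E.card : ℝ) ≠ 0 := by
    intro h
    rw [h, mul_zero, zero_div] at hd
    linarith
  field_simp

theorem IsAdmissible.nonempty {E : Finset (L × R)} (hE : IsAdmissible E) : E.Nonempty := by
  rw [Finset.nonempty_iff_ne_empty]
  rintro rfl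
  have hd := hE.one_le_avgDeg
  simp only [avgDeg, Finset.card_empty, Nat.cast_zero, mul_zero, zero_div] at hd
  linarith

/-- The reason for the shape of the thresholds: raising `f` to the power `log log n / 2 ^ i + 1`
gives exactly `f log n`, the base in the right degree bound. -/
theorem two_rpow_pow_threshold {Λ X : ℝ} (hΛ : 0 < Λ) (i : ℕ) :
    ((2 : ℝ) ^ 2 ^ i) ^ (X * (Real.logb 2 Λ / 2 ^ i + 1)) = ((2 : ℝ) ^ 2 ^ i * Λ) ^ X := by
  have h1 : ((2 : ℝ) ^ 2 ^ i * Λ) = 2 ^ ((2 : ℝ) ^ i + Real.logb 2 Λ) := by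
    rw [Real.rpow_add two_pos, Real.rpow_logb two_pos (by norm_num) hΛ,
      ← Real.rpow_natCast 2 (2 ^ i)]
    push_cast
    rfl
  rw [h1, ← Real.rpow_natCast 2 (2 ^ i), ← Real.rpow_mul zero_le_two, ← Real.rpow_mul zero_le_two]
  congr 1
  push_cast
  field_simp
  ring

/-- The branching factor at a right vertex is small. -/
theorem extensionWeight_le {E : Finset (L × R)} (hE : IsAdmissible E) {K M c : ℝ} (hK : 16 ≤ K)
    (hM : 2 ≤ M) (hc : 16 + 6 * K ≤ c) {h : ℕ} {cls : L × R → Fin h}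
    (hcls : IsSkewDecomposition E K M cls) (hn : 4 ≤ Real.logb 2 (order L R : ℝ)) (D : ℕ) (y : R) :
    extensionWeight E cls (fun i => ⌈threshold E c i⌉₊) D (order L R) y ≤
      2 * K * M / Real.logb 2 (order L R : ℝ) ^ 6 := by
  set Λ := Real.logb 2 (order L R : ℝ) with hΛ
  have hd := hE.one_le_avgDeg
  have hρ := avgDeg_le_two_mul_maxDensity E
  have hs := hE.skew_nonneg (by linarith)
  set ρ := maxDensity E / avgDeg E with hρd
  have hρ2 : 1 / 2 ≤ ρ := by
    rw [hρd, le_div_iff₀ (by linarith)]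
    linarith
  have hℓ : 0 ≤ Real.logb 2 Λ := Real.logb_nonneg one_lt_two (by linarith)
  have hℓΛ : Real.logb 2 Λ ≤ Λ := by
    rw [Real.logb_le_iff_le_rpow one_lt_two (by linarith)]
    have := one_add_mul_self_le_rpow_one_add (s := 1) (by norm_num) (p := Λ) (by linarith)
    norm_num at this
    linarith
  have hclass : ∀ i : Fin h, ∑ e ∈ edgeClass E cls i with e.2 = y,
      (order L R : ℝ) * ((order L R * leftDeg (edgeClass E cls i) e.1).choose
        ⌈threshold E c i⌉₊ * (1 / (E.card : ℝ)) ^ (1 + ⌈threshold E c i⌉₊)) ≤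
        2 * K * Λ ^ (-7 : ℝ) := by
    intro i
    set f : ℝ := 2 ^ 2 ^ ((i : ℕ) + 1) with hf
    have hf1 : 1 ≤ f := one_le_pow₀ one_le_two
    set a := ⌈threshold E c i⌉₊ with ha
    have hthr : threshold E c i = c * (ρ + skew E) * (Real.logb 2 Λ / 2 ^ ((i : ℕ) + 1) + 1) := rfl
    have haα : threshold E c i ≤ a := Nat.le_ceil _
    have hα : c * ρ ≤ threshold E c i := by
      rw [hthr]
      have h1 : c * ρ ≤ c * (ρ + skew E) := by nlinarith
      have h2 : 0 ≤ Real.logb 2 Λ / 2 ^ ((i : ℕ) + 1) := by positivity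
      exact h1.trans (le_mul_of_one_le_right (mul_nonneg (by linarith) (by linarith))
        (by linarith))
    have hz1 : Λ ≤ f * Λ := by nlinarith
    -- The tail bound with `b = 1 / f`: three times the mean number of class arrivals at `x` is at
    -- most `6 K ρ / f`, and `a ≥ c ρ ≥ 6 K ρ`. This is the term `6 * K` in the bound on `c`.
    have hheavy : ∀ x, ((order L R * leftDeg (edgeClass E cls i) x).choose a : ℝ) *
        (1 / (E.card : ℝ)) ^ a ≤ (f * Λ) ^ (-(c * (ρ + skew E))) := by
      intro x
      have h1 := (hcls.biregular i).left_degree_le x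
      have h2 : 3 * (((order L R * leftDeg (edgeClass E cls i) x : ℕ) : ℝ) * (1 / (E.card : ℝ))) ≤
          1 / f * a := by
        push_cast
        rw [mul_right_comm, order_div_card hE]
        calc 3 * (2 / avgDeg E * leftDeg (edgeClass E cls i) x)
            ≤ 3 * (2 / avgDeg E * (K * (maxDensity E / f))) := by gcongr
          _ = 1 / f * (6 * K * ρ) := by rw [hρd]; ring
          _ ≤ 1 / f * a := by
            refine mul_le_mul_of_nonneg_left ?_ (by positivity)
            nlinarith
      refine (choose_mul_pow_le (by positivity) h2).trans ?_
      rw [one_div, inv_pow, Real.rpow_neg (by nlinarith), hf, ← two_rpow_pow_threshold (by linarith),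
        ← hf]
      refine inv_anti₀ (by positivity) ?_
      rw [← Real.rpow_natCast f a]
      exact Real.rpow_le_rpow_of_exponent_le hf1 haα
    -- Bernoulli's inequality absorbs the factor `ρ* / d`, which may be large, into a power of the
    -- common base `f Λ`.
    have hρz : ρ ≤ (f * Λ) ^ (2 * ρ) := by
      have := one_add_mul_self_le_rpow_one_add (s := f * Λ - 1) (by linarith) (p := 2 * ρ)
        (by linarith)
      rw [add_sub_cancel] at this
      nlinarith
    have hterm : ∀ e ∈ (edgeClass E cls i).filter fun e => e.2 = y,
        (order L R : ℝ) * ((order L R * leftDeg (edgeClass E cls i) e.1).choose a *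
          (1 / (E.card : ℝ)) ^ (1 + a)) ≤
          2 / avgDeg E * (f * Λ) ^ (-(c * (ρ + skew E))) := by
      intro e _
      rw [← order_div_card hE, pow_add, pow_one, mul_left_comm _ (1 / (E.card : ℝ)), ← mul_assoc]
      exact mul_le_mul_of_nonneg_left (hheavy e.1) (by positivity)
    refine (Finset.sum_le_sum hterm).trans ?_
    rw [Finset.sum_const, nsmul_eq_mul]
    have hr : ((((edgeClass E cls i).filter fun e => e.2 = y).card : ℕ) : ℝ) ≤
        K * (maxDensity E * (f * Λ) ^ (2 * skew E)) := (hcls.biregular i).right_degree_le y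
    have hz0 : 0 < f * Λ := by nlinarith
    calc (((edgeClass E cls i).filter fun e => e.2 = y).card : ℝ) *
          (2 / avgDeg E * (f * Λ) ^ (-(c * (ρ + skew E))))
        ≤ K * (maxDensity E * (f * Λ) ^ (2 * skew E)) *
          (2 / avgDeg E * (f * Λ) ^ (-(c * (ρ + skew E)))) := by gcongr
      _ = 2 * K * (ρ * ((f * Λ) ^ (2 * skew E) * (f * Λ) ^ (-(c * (ρ + skew E))))) := by
        rw [hρd]; ring
      _ ≤ 2 * K * ((f * Λ) ^ (2 * ρ) *
          ((f * Λ) ^ (2 * skew E) * (f * Λ) ^ (-(c * (ρ + skew E))))) := by gcongr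
      _ = 2 * K * (f * Λ) ^ (2 * ρ + (2 * skew E + -(c * (ρ + skew E)))) := by
        rw [← Real.rpow_add hz0, ← Real.rpow_add hz0]
      _ ≤ 2 * K * (f * Λ) ^ (-7 : ℝ) := by
        refine mul_le_mul_of_nonneg_left
          (Real.rpow_le_rpow_of_exponent_le (by linarith) ?_) (by positivity)
        -- The exponent is at most `(2 - c) (ρ + skew E)`; as `ρ ≥ 1 / 2` and `c ≥ 16`, this is at
        -- most `-7`.
        nlinarith
      _ ≤ 2 * K * Λ ^ (-7 : ℝ) := by
        refine mul_le_mul_of_nonneg_left ?_ (by positivity)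
        exact Real.rpow_le_rpow_of_nonpos (by linarith) hz1 (by norm_num)
  have hΛ0 : 0 < Λ := by linarith
  unfold extensionWeight
  refine (Finset.sum_le_sum fun i _ => hclass i).trans ?_
  rw [Finset.sum_const, nsmul_eq_mul]
  have hcardh : (((Finset.univ.filter fun i : Fin h => ⌈threshold E c i⌉₊ ≤ D).card : ℕ) : ℝ) ≤
      M * Λ := by
    have h1 : (Finset.univ.filter fun i : Fin h => ⌈threshold E c i⌉₊ ≤ D).card ≤ h :=
      (Finset.card_le_univ _).trans (Fintype.card_fin h).le
    refine (Nat.cast_le.2 h1).trans (hcls.card_le.trans ?_)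
    exact mul_le_mul_of_nonneg_left hℓΛ (by linarith)
  refine (mul_le_mul_of_nonneg_right hcardh (by positivity)).trans (le_of_eq ?_)
  rw [Real.rpow_neg hΛ0.le, show (7 : ℝ) = ((7 : ℕ) : ℝ) by norm_num, Real.rpow_natCast]
  field_simp

/-! ### The high-probability bound and the choice of constants -/

/-- The component bound, with explicit conditions on the size of the graph. -/
theorem IsAdmissible.prob_components_ge {E : Finset (L × R)} (hE : IsAdmissible E) {K M c : ℝ}
    (hK : 16 ≤ K) (hM : 2 ≤ M) (hc : 16 + 6 * K ≤ c) {h : ℕ} {cls : L × R → Fin h}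
    (hcls : IsSkewDecomposition E K M cls) (k : ℕ) (hn : 4 ≤ Real.logb 2 (order L R : ℝ))
    (hbig : 4 * K * M * (k + 17) * 2 ^ (k + 3) ≤ Real.logb 2 (order L R : ℝ)) :
    1 - 1 / (order L R : ℝ) ^ k ≤ (arrivals E (order L R)).real
      {ω | ∀ κ : (greedyGraph (threshold E c) cls (fun t => (ω t).val)).ConnectedComponent,
        (κ.supp.ncard : ℝ) ≤ (2 * k + 29) * Real.logb 2 (order L R : ℝ) ^ 2} := by
  have hne := hE.nonempty
  have := nonempty_edge hne
  have hd := hE.one_le_avgDeg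
  set n := order L R with hnn
  set Λ := Real.logb 2 (n : ℝ) with hΛ
  have hΛ0 : 0 < Λ := by linarith
  have hn0 : 0 < n := by
    rcases Nat.eq_zero_or_pos n with h0 | h0
    · rw [hΛ, h0, Nat.cast_zero, Real.logb_zero] at hn
      linarith
    · exact h0
  have hn0' : (0 : ℝ) < n := Nat.cast_pos.2 hn0
  have hn1 : (1 : ℝ) ≤ n := Nat.one_le_cast.2 hn0
  have hnΛ : (2 : ℝ) ^ Λ = n := Real.rpow_logb two_pos (by norm_num) hn0'
  have hpow : ∀ r N : ℕ, (r : ℝ) * Λ ≤ N → (1 / 2 : ℝ) ^ N ≤ 1 / (n : ℝ) ^ r := by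
    intro r N hrN
    rw [one_div_pow]
    refine one_div_le_one_div_of_le (by positivity) ?_
    rw [← hnΛ, ← Real.rpow_natCast, ← Real.rpow_mul zero_le_two, ← Real.rpow_natCast 2 N]
    exact Real.rpow_le_rpow_of_exponent_le one_le_two (by linarith)
  set m := ⌈Λ⌉₊ with hm
  have hmΛ : Λ ≤ m := Nat.le_ceil _
  have hmΛ2 : (m : ℝ) ≤ 2 * Λ := by linarith [Nat.ceil_lt_add_one hΛ0.le]
  -- The tail bound with `b = 1 / 2` needs `D ≥ 12 Λ`, as the mean arrival degree is at most `2 Λ`;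
  -- the target `n ^ -(k + 3)` needs `D ≥ (k + 3) Λ`.
  set D := ⌈(k + 12) * Λ⌉₊ with hD
  have hDΛ : (k + 12) * Λ ≤ D := Nat.le_ceil _
  have hDΛ2 : (D : ℝ) ≤ (k + 13) * Λ := by
    linarith [Nat.ceil_lt_add_one (show 0 ≤ (k + 12) * Λ by positivity)]
  have hm2 : 2 ≤ m := by
    have : (2 : ℝ) ≤ m := by linarith
    exact_mod_cast this
  set μ := arrivals E n with hμ
  have hB1 : μ.real {ω | ∃ x ∈ (Finset.univ : Finset L), D ≤ arrivalDeg (fun t => (ω t).val) x} ≤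
      Fintype.card L * (1 / (n : ℝ) ^ (k + 3)) := by
    rw [← nsmul_eq_mul, ← Finset.card_univ, ← Finset.sum_const]
    refine measureReal_exists_le μ _ _ _ fun x _ => (prob_arrivalDeg_le hne n D x).trans ?_
    refine (choose_mul_pow_le (b := 1 / 2) (by positivity) ?_).trans (hpow (k + 3) D ?_)
    · push_cast
      rw [mul_right_comm, order_div_card hE]
      have h1 := hE.left_degree_le_log x
      calc 3 * (2 / avgDeg E * leftDeg E x) ≤ 3 * (2 / avgDeg E * (Λ * avgDeg E)) := by gcongr
        _ = 6 * Λ := by field_simp; norm_num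
        _ ≤ 1 / 2 * D := by nlinarith [(Nat.cast_nonneg k : (0 : ℝ) ≤ k)]
    · push_cast
      linarith
  have hB2 : μ.real {ω | ∃ y ∈ (Finset.univ : Finset R),
      Chain E cls (fun i => ⌈threshold E c i⌉₊) D m ∅ y fun t => (ω t).val} ≤
      Fintype.card R * (1 / (n : ℝ) ^ (k + 3)) := by
    rw [← nsmul_eq_mul, ← Finset.card_univ, ← Finset.sum_const]
    refine measureReal_exists_le μ _ _ _ fun y _ => ?_
    refine (prob_chain_le hne cls _ D m n (β := 2 * K * M / Λ ^ 6) (Δ := Λ * avgDeg E)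
      (by positivity) (extensionWeight_le hE hK hM hc hcls hn D) (by positivity)
      hE.left_degree_le_log m ∅ y (by simp [leftVerts]) (by simp)).trans ?_
    rw [Finset.card_empty, pow_zero, mul_one]
    have hγ : (m : ℝ) * (D + 2) + n * (m * (Λ * avgDeg E)) * (1 / (E.card : ℝ)) ≤
        2 * (k + 17) * Λ ^ 2 := by
      rw [mul_right_comm (n : ℝ), order_div_card hE]
      calc (m : ℝ) * (D + 2) + 2 / avgDeg E * (m * (Λ * avgDeg E))
          = m * (D + 2 + 2 * Λ) := by field_simp
        _ ≤ (2 * Λ) * ((k + 13) * Λ + 2 * Λ + 2 * Λ) := by gcongr; linarith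
        _ = _ := by ring
    -- The product of the two costs of a stage is `O(Λ ^ (-4))`, so at most `2 ^ -(k + 3)` for large
    -- `n`; then `m ≥ Λ` stages give `n ^ -(k + 3)`.
    have hstage : 2 * K * M / Λ ^ 6 *
        ((m : ℝ) * (D + 2) + n * (m * (Λ * avgDeg E)) * (1 / (E.card : ℝ))) ≤
          (1 / 2) ^ (k + 3) := by
      refine (mul_le_mul_of_nonneg_left hγ (by positivity)).trans ?_
      have h1 : 2 * K * M / Λ ^ 6 * (2 * (k + 17) * Λ ^ 2) = 4 * K * M * (k + 17) / Λ ^ 4 := by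
        field_simp
        ring
      have h2 : Λ ≤ Λ ^ 4 := le_self_pow₀ (by linarith) (by norm_num)
      rw [h1, one_div_pow, div_le_div_iff₀ (by positivity) (by positivity)]
      linarith
    refine (pow_le_pow_left₀ (by positivity) hstage m).trans ?_
    rw [← pow_mul]
    refine hpow (k + 3) _ ?_
    push_cast
    gcongr
  have hcover : (Set.univ : Set (Fin n → Edge E)) ⊆
      ({ω | ∀ κ : (greedyGraph (threshold E c) cls (fun t => (ω t).val)).ConnectedComponent,
        (κ.supp.ncard : ℝ) ≤ (2 * k + 29) * Λ ^ 2} ∪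
      {ω | ∃ x ∈ (Finset.univ : Finset L), D ≤ arrivalDeg (fun t => (ω t).val) x}) ∪
      {ω | ∃ y ∈ (Finset.univ : Finset R),
        Chain E cls (fun i => ⌈threshold E c i⌉₊) D m ∅ y fun t => (ω t).val} := by
    intro ω _
    by_cases h1 : ∃ x ∈ (Finset.univ : Finset L), D ≤ arrivalDeg (fun t => (ω t).val) x
    · exact Or.inl (Or.inr h1)
    by_cases h2 : ∃ y ∈ (Finset.univ : Finset R),
        Chain E cls (fun i => ⌈threshold E c i⌉₊) D m ∅ y fun t => (ω t).val
    · exact Or.inr h2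
    refine Or.inl (Or.inl fun κ => ?_)
    have hdeg : ∀ x, arrivalDeg (fun t => (ω t).val) x ≤ D := fun x => by
      by_contra! hx
      exact h1 ⟨x, Finset.mem_univ x, hx.le⟩
    have hκ : (compLeft κ).card ≤ m := by
      by_contra! hκ
      obtain ⟨y, hy⟩ := exists_chain (E := E) (fun t => (ω t).2) hdeg κ hm2 hκ.le
      exact h2 ⟨y, Finset.mem_univ y, hy⟩
    have h3 : (κ.supp.ncard : ℝ) ≤ 1 + m * (D + 1) := by exact_mod_cast ncard_supp_le hdeg κ hκ
    refine h3.trans ?_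
    calc 1 + (m : ℝ) * (D + 1) ≤ Λ ^ 2 + 2 * Λ * ((k + 13) * Λ + Λ) := by
          gcongr
          · nlinarith
          · linarith
      _ = _ := by ring
  have hone : 1 ≤ μ.real ({ω | ∀ κ : (greedyGraph (threshold E c) cls
        (fun t => (ω t).val)).ConnectedComponent,
        (κ.supp.ncard : ℝ) ≤ (2 * k + 29) * Λ ^ 2}) +
      Fintype.card L * (1 / (n : ℝ) ^ (k + 3)) + Fintype.card R * (1 / (n : ℝ) ^ (k + 3)) := by
    calc (1 : ℝ) = μ.real Set.univ := probReal_univ.symm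
      _ ≤ _ := measureReal_mono hcover
      _ ≤ _ := measureReal_union_le _ _
      _ ≤ _ := add_le_add ((measureReal_union_le _ _).trans (add_le_add le_rfl hB1)) hB2
  have hsum : Fintype.card L * (1 / (n : ℝ) ^ (k + 3)) + Fintype.card R * (1 / (n : ℝ) ^ (k + 3)) ≤
      1 / (n : ℝ) ^ k := by
    have h1 : (Fintype.card L : ℝ) + Fintype.card R = n := by
      rw [hnn, order]
      push_cast
      rfl
    rw [← add_mul, h1, mul_one_div, div_le_div_iff₀ (by positivity) (by positivity), one_mul,
      ← pow_succ']
    exact pow_le_pow_right₀ hn1 (by omega)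
  linarith

theorem exists_forall_le_logb (Q : ℝ) : ∃ N : ℕ, ∀ n ≥ N, Q ≤ Real.logb 2 (n : ℝ) :=
  Filter.eventually_atTop.1 (((Real.tendsto_logb_atTop one_lt_two).comp
    tendsto_natCast_atTop_atTop).eventually_ge_atTop Q)

end ThresholdGreedy

theorem mainTheorem6 :
    ∃ K₀ M₀ : ℝ, ∀ K ≥ K₀, ∀ M ≥ M₀, ∃ c₀ : ℝ, 0 < c₀ ∧ ∀ k : ℕ, ∃ (C : ℝ) (N : ℕ),
      ∀ (L : Type*) (R : Type*) [Fintype L] [Fintype R] [DecidableEq L] [DecidableEq R]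
        (E : Finset (L × R)),
        N ≤ ThresholdGreedy.order L R → ThresholdGreedy.IsAdmissible E →
          (∃ (h : ℕ) (cls : L × R → Fin h), ThresholdGreedy.IsSkewDecomposition E K M cls) ∧
          ∀ (h : ℕ) (cls : L × R → Fin h), ThresholdGreedy.IsSkewDecomposition E K M cls →
            ∀ c ≥ c₀,
              1 - 1 / (ThresholdGreedy.order L R : ℝ) ^ k ≤
                (ThresholdGreedy.arrivals E (ThresholdGreedy.order L R)).real
                  {ω | ∀ κ : (ThresholdGreedy.greedyGraph
                        (ThresholdGreedy.threshold E c) cls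
                        (fun t => (ω t).val)).ConnectedComponent,
                      (κ.supp.ncard : ℝ) ≤
                        C * Real.logb 2 (ThresholdGreedy.order L R : ℝ) ^ 2} := by
  -- The constant `c₀` depends on `K` alone: a larger `k` is paid for by `C` and by the size of the
  -- graph.
  refine ⟨16, 2, fun K hK M hM => ⟨16 + 6 * K, by linarith, fun k => ?_⟩⟩
  obtain ⟨N, hN⟩ := ThresholdGreedy.exists_forall_le_logb
    (max 4 (4 * K * M * (k + 17) * 2 ^ (k + 3)))
  obtain ⟨N', hN'⟩ := exists_nat_gt K
  refine ⟨2 * k + 29, max N N', fun L R _ _ _ _ E hn hE => ?_⟩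
  have hΛ := hN _ ((le_max_left N N').trans hn)
  have hΛ4 := (le_max_left _ _).trans hΛ
  refine ⟨hE.exists_decomposition hK hM (by linarith) (hN'.trans_le ?_), fun h cls hcls c hc =>
    hE.prob_components_ge hK hM hc hcls k hΛ4 ((le_max_right _ _).trans hΛ)⟩
  exact Nat.cast_le.2 ((le_max_right N N').trans hn)
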